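/- Let $G$ be a locally compact group with a (regular) left Haar measure, let $1<p<\infty$ and $\frac1p+\frac1{p'}=1$. The Figà-Talamanca–Herz algebra $A_p(G)$ consists of those functions $f\colon G\to\mathbb C$ that can be written as $f=\sum_{n=1}^\infty \xi_n*\check\eta_n$ with $\xi_n\in L^p(G)$, $\eta_n\in L^{p'}(G)$ and $\sum_{n=1}^\infty\|\xi_n\|_p\|\eta_n\|_{p'}<\infty$, where $\check\eta(x)=\eta(x^{-1})$; its norm $\|f\|$ is the infimum of $\sum_n\|\xi_n\|_p\|\eta_n\|_{p'}$ over all such representations of $f$. Let $G_d$ denote the group $G$ with the discrete topology. **Proposition.** Let $(f_\alpha)_{\alpha\in\mathbb A}$ be a bounded net in $A_p(G)$ that converges pointwise on $G$ to a function $f\colon G\to\mathbb C$. Then there are a measure space $X$ and an isometric representation $\pi$ of $G_d$ on $L^{p'}(X)$ (that is, a group homomorphism from $G$ into the group of invertible linear isometries of $L^{p'}(X)$) such that $f$ is a coefficient function of $\pi$, i.e. $f(x)=\langle\pi(x)\eta,\phi\rangle$ $(x\in G)$ for some $\eta\in L^{p'}(X)$ and $\phi\in L^{p'}(X)^*$.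 More precisely, if $C\ge 0$ is such that $\sup_\alpha\|f_\alpha\|\le C$, then there are $\eta\in L^{p'}(X)$ and $\xi\in L^p(X)$ with $\|\eta\|\,\|\xi\|\le C$ and $$f(x)=\langle\pi(x)\eta,\xi\rangle=\int_X(\pi(x)\eta)\,\xi \qquad(x\in G).$$ -/

import Mathlib

open MeasureTheory Filter Topology
open scoped ENNReal

universe u v

noncomputable section

namespace FigaTalamancaHerz

section Algebra

variable {G : Type*} [Group G]

/-- The function `x ↦ f (x⁻¹)`. -/
def check (f : G → ℂ) : G → ℂ := fun x => f x⁻¹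

variable [MeasurableSpace G]

/-- Convolution of two functions on a group with respect to a (left Haar) measure `μ`:
`(f ∗ g)(x) = ∫ f(y) g(y⁻¹ x) dμ(y)`. -/
def conv (μ : Measure G) (f g : G → ℂ) : G → ℂ :=
  fun x => ∫ y, f y * g (y⁻¹ * x) ∂μ

/-- `f = ∑ ξₙ ∗ (ηₙ)ˇ` with `ξₙ ∈ L^p(G)`, `ηₙ ∈ L^{p'}(G)` and `∑ ‖ξₙ‖ ‖ηₙ‖ = s < ∞`.
Each integral defining `ξₙ ∗ (ηₙ)ˇ` is the integral of a product of an `L^p` function with (for a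
left invariant `μ`) an `L^{p'}` function, and `|(ξₙ ∗ (ηₙ)ˇ)(x)| ≤ ‖ξₙ‖ ‖ηₙ‖`, so that the series
of functions converges absolutely and uniformly; it is summed pointwise here. -/
structure IsExpansion (μ : Measure G) (p p' : ℝ≥0∞) (f : G → ℂ)
    (ξ : ℕ → Lp ℂ p μ) (η : ℕ → Lp ℂ p' μ) (s : ℝ) : Prop where
  hasSum_norm : HasSum (fun n => ‖ξ n‖ * ‖η n‖) s
  hasSum_apply : ∀ x, HasSum (fun n => conv μ (ξ n) (check (η n)) x) (f x)

/-- The Figà-Talamanca–Herz algebra `A_p(G)`, as a set of functions on `G`;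
`p'` is meant to be the conjugate exponent of `p`, and `μ` a left Haar measure. -/
def A (μ : Measure G) (p p' : ℝ≥0∞) : Set (G → ℂ) :=
  {f | ∃ ξ η s, IsExpansion μ p p' f ξ η s}

/-- The norm of `A_p(G)`: the infimum of `∑ ‖ξₙ‖ ‖ηₙ‖` over all expansions of `f`. -/
def normA (μ : Measure G) (p p' : ℝ≥0∞) (f : G → ℂ) : ℝ :=
  sInf {s | ∃ ξ η, IsExpansion μ p p' f ξ η s}

end Algebra

section Representation

variable {G : Type*} [Group G] {E : Type*} [NormedAddCommGroup E] [NormedSpace ℂ E]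

/-- An isometric representation on `E` of the group `G` with the discrete topology: a group
homomorphism into the invertible linear isometries of `E`. (Strong operator continuity with respect
to the discrete topology holds automatically.) -/
abbrev DiscreteIsometricRep (G : Type*) [Group G]
    (E : Type*) [NormedAddCommGroup E] [NormedSpace ℂ E] : Type _ :=
  G →* (E ≃ₗᵢ[ℂ] E)

/-- `f` is a coefficient function of `π`: `f(x) = ⟨π(x)η, φ⟩` for some `η ∈ E` and `φ ∈ E*`. -/
def IsCoefficientFunction (π : DiscreteIsometricRep G E) (f : G → ℂ) : Prop :=
  ∃ (η : E) (φ : StrongDual ℂ E), ∀ x, f x = φ (π x η)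

end Representation

end FigaTalamancaHerz

end

/-! Write q for p'. After rescaling its terms, an expansion of total mass s exhibits a function in
A_p(G) as a single coefficient x ↦ ∫ H(x⁻¹·) Ξ of left translation on L^q(ℕ × G), with ‖H‖^q = ‖Ξ‖^p
= s (`IsExpansion.exists_integral_eq`). Along an ultrafilter on ι × ℕ the masses s converge to some
σ ≤ sup ‖f_α‖. The vectors H define an element of the ultrapower of L^q(ℕ × G), the functionals
given by Ξ have a limit Φ, and translation acts isometrically coordinate by coordinate; f is the
resulting coefficient (`exists_rep_of_tendsto_coefficients`). Two facts remain.

The ultrapower is isometric to an L^q-space. Measurable subsets of a disjoint union of copies of ℕ ×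
G act on it slicewise by projections that split the q-th power of the norm. Given h and g, on the
set where |h| ≤ n|g| the vector h is a bounded multiple of g, hence a limit of simple functions
times g, while g is small off that set for large n (`multiplicityFree_ultrapower_LpSystem`). So
Zorn's lemma yields pairwise disjoint vectors e whose images under the projections have dense span.
Norms in that span depend only on the numbers ‖P_A e‖^q, finitely additive in A, which become a
measure on a Stone space (`exists_stone_measure`). Matching the e with indicator functions gives the
isometry (`MultiplicityFree.exists_linearIsometryEquiv_Lp`).

Φ is the pairing with an element of L^p. It attains its norm at the class of the norming vectors of
the Ξ, and differentiating the norm there identifies it (`exists_integral_repr_of_norm_attained`),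
so general duality of L^q is not needed. -/

open scoped symmDiff

universe w

/-! ### Projections splitting the q-th power of the norm, and disjoint vectors -/

/-- A Boolean system of projections on `B`, indexed by the measurable subsets of `Ω`, for which
`B` is the `ℓ^q`-sum of the ranges of complementary projections. -/
structure ProjSystem (q : ℝ) (Ω : Type*) [MeasurableSpace Ω] (B : Type*) [NormedAddCommGroup B]
    [NormedSpace ℂ B] where
  proj : Set Ω → B →ₗ[ℂ] B
  proj_univ : ∀ b, proj Set.univ b = b
  proj_inter : ∀ {A D : Set Ω}, MeasurableSet A → MeasurableSet D → ∀ b,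
    proj (A ∩ D) b = proj A (proj D b)
  proj_union : ∀ {A D : Set Ω}, MeasurableSet A → MeasurableSet D → Disjoint A D → ∀ b,
    proj (A ∪ D) b = proj A b + proj D b
  norm_rpow : ∀ {A : Set Ω}, MeasurableSet A → ∀ b,
    ‖b‖ ^ q = ‖proj A b‖ ^ q + ‖proj Aᶜ b‖ ^ q

namespace ProjSystem

variable {q : ℝ} {Ω : Type*} [MeasurableSpace Ω] {B : Type*} [NormedAddCommGroup B]
  [NormedSpace ℂ B] (P : ProjSystem q Ω B)

theorem proj_empty (b : B) : P.proj ∅ b = 0 := by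
  have := P.proj_union (A := ∅) (D := ∅) .empty .empty (by simp) b
  simpa using this

theorem proj_add_compl {A : Set Ω} (hA : MeasurableSet A) (b : B) :
    P.proj A b + P.proj Aᶜ b = b := by
  rw [← P.proj_union hA hA.compl disjoint_compl_right, Set.union_compl_self, P.proj_univ]

theorem proj_comm {A D : Set Ω} (hA : MeasurableSet A) (hD : MeasurableSet D) (b : B) :
    P.proj A (P.proj D b) = P.proj D (P.proj A b) := by
  rw [← P.proj_inter hA hD, Set.inter_comm, P.proj_inter hD hA]

theorem proj_compl_proj {A : Set Ω} (hA : MeasurableSet A) (b : B) :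
    P.proj Aᶜ (P.proj A b) = 0 := by
  rw [← P.proj_inter hA.compl hA, Set.compl_inter_self, P.proj_empty]

theorem norm_proj_le (hq : 0 < q) {A : Set Ω} (hA : MeasurableSet A) (b : B) :
    ‖P.proj A b‖ ≤ ‖b‖ := by
  have h := P.norm_rpow hA b
  have h2 : 0 ≤ ‖P.proj Aᶜ b‖ ^ q := by positivity
  exact (Real.rpow_le_rpow_iff (norm_nonneg _) (norm_nonneg _) hq).1 (by linarith)

theorem continuous_proj (hq : 0 < q) {A : Set Ω} (hA : MeasurableSet A) :
    Continuous (P.proj A) :=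
  ((P.proj A).mkContinuous 1 fun b => by simpa using P.norm_proj_le hq hA b).continuous

theorem norm_proj_mono (hq : 0 < q) {A D : Set Ω} (hA : MeasurableSet A) (hD : MeasurableSet D)
    (h : A ⊆ D) (b : B) : ‖P.proj A b‖ ≤ ‖P.proj D b‖ := by
  rw [← Set.inter_eq_self_of_subset_left h, P.proj_inter hA hD]
  exact P.norm_proj_le hq hA _

/-- Two vectors are disjoint if they are asymptotically carried by complementary sets. -/
def Disj (x y : B) : Prop :=
  ∃ A : ℕ → Set Ω, (∀ n, MeasurableSet (A n)) ∧ Tendsto (fun n => P.proj (A n) x) atTop (𝓝 0) ∧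
    Tendsto (fun n => P.proj (A n)ᶜ y) atTop (𝓝 0)

variable {P}

theorem Disj.symm {x y : B} (h : P.Disj x y) : P.Disj y x := by
  obtain ⟨A, hA, h1, h2⟩ := h
  exact ⟨fun n => (A n)ᶜ, fun n => (hA n).compl, h2, by simpa using h1⟩

/-- The two projections of x + y along the sets A n tend to y and to x, so the splitting identity
for x + y passes to the limit. -/
theorem Disj.norm_rpow_add (hq : 0 < q) {x y : B} (h : P.Disj x y) :
    ‖x + y‖ ^ q = ‖x‖ ^ q + ‖y‖ ^ q := by
  obtain ⟨A, hA, h1, h2⟩ := h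
  have h3 : Tendsto (fun n => P.proj (A n) y) atTop (𝓝 y) := by
    have : (fun n => P.proj (A n) y) = fun n => y - P.proj (A n)ᶜ y := by
      ext n; rw [eq_sub_iff_add_eq, P.proj_add_compl (hA n)]
    rw [this]; simpa using h2.const_sub y
  have h4 : Tendsto (fun n => P.proj (A n)ᶜ x) atTop (𝓝 x) := by
    have : (fun n => P.proj (A n)ᶜ x) = fun n => x - P.proj (A n) x := by
      ext n; rw [eq_sub_iff_add_eq', P.proj_add_compl (hA n)]
    rw [this]; simpa using h1.const_sub x
  have h5 := ((h1.add h3).norm.rpow_const (p := q) (.inr hq.le)).add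
    ((h4.add h2).norm.rpow_const (p := q) (.inr hq.le))
  simp only [zero_add, add_zero, ← map_add] at h5
  simp only [← P.norm_rpow (hA _)] at h5
  rw [tendsto_nhds_unique tendsto_const_nhds h5, add_comm]

theorem Disj.eq_zero {x : B} (h : P.Disj x x) : x = 0 := by
  obtain ⟨A, hA, h1, h2⟩ := h
  have := h1.add h2
  simp only [P.proj_add_compl (hA _), add_zero] at this
  exact tendsto_nhds_unique tendsto_const_nhds this

theorem disj_zero_left (y : B) : P.Disj 0 y :=
  ⟨fun _ => Set.univ, fun _ => .univ, by simp, by simp [P.proj_empty]⟩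

theorem Disj.add_left (hq : 0 < q) {x x' y : B} (h : P.Disj x y) (h' : P.Disj x' y) :
    P.Disj (x + x') y := by
  obtain ⟨A, hA, h1, h2⟩ := h
  obtain ⟨A', hA', h1', h2'⟩ := h'
  refine ⟨fun n => A n ∩ A' n, fun n => (hA n).inter (hA' n), ?_, ?_⟩
  · rw [tendsto_zero_iff_norm_tendsto_zero] at *
    refine squeeze_zero (fun _ => norm_nonneg _) (fun n => ?_) (by simpa using h1.add h1')
    rw [map_add]
    refine (norm_add_le _ _).trans (add_le_add ?_ ?_)
    · exact P.norm_proj_mono hq ((hA n).inter (hA' n)) (hA n) Set.inter_subset_left _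
    · exact P.norm_proj_mono hq ((hA n).inter (hA' n)) (hA' n) Set.inter_subset_right _
  · rw [tendsto_zero_iff_norm_tendsto_zero] at *
    refine squeeze_zero (fun _ => norm_nonneg _) (fun n => ?_) (by simpa using h2.add h2')
    -- A disjoint decomposition is needed for additivity; y is asymptotically small on each of the
    -- two pieces.
    have : (A n ∩ A' n)ᶜ = (A n)ᶜ ∪ (A n \ A' n) := by ext; simp; tauto
    rw [this, P.proj_union (hA n).compl ((hA n).diff (hA' n))
      (Set.disjoint_left.2 fun a ha hb => ha hb.1)]
    refine (norm_add_le _ _).trans (add_le_add le_rfl ?_)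
    exact P.norm_proj_mono hq ((hA n).diff (hA' n)) (hA' n).compl (fun a ha => ha.2) _

theorem Disj.smul_left (c : ℂ) {x y : B} (h : P.Disj x y) : P.Disj (c • x) y := by
  obtain ⟨A, hA, h1, h2⟩ := h
  exact ⟨A, hA, by simpa using h1.const_smul c, h2⟩

theorem Disj.proj_left (hq : 0 < q) {D : Set Ω} (hD : MeasurableSet D) {x y : B}
    (h : P.Disj x y) : P.Disj (P.proj D x) y := by
  obtain ⟨A, hA, h1, h2⟩ := h
  refine ⟨A, hA, ?_, h2⟩
  simp only [P.proj_comm (hA _) hD]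
  have h3 := ((P.continuous_proj hq hD).tendsto 0).comp h1
  rwa [map_zero] at h3

variable (P)

/-- The span of the images of `e` under the projections. -/
def cyclic (e : B) : Submodule ℂ B :=
  Submodule.span ℂ {b | ∃ A : Set Ω, MeasurableSet A ∧ P.proj A e = b}

variable {P}

theorem Disj.of_mem_cyclic_left (hq : 0 < q) {e y : B} (h : P.Disj e y) {x : B}
    (hx : x ∈ P.cyclic e) : P.Disj x y := by
  induction hx using Submodule.span_induction with
  | mem x hx => obtain ⟨A, hA, rfl⟩ := hx; exact h.proj_left hq hA
  | zero => exact disj_zero_left y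
  | add x x' _ _ h1 h2 => exact h1.add_left hq h2
  | smul c x _ h1 => exact h1.smul_left c

theorem norm_rpow_sum (hq : 0 < q) {I : Type*} {x : I → B} (s : Finset I)
    (h : ∀ i j, i ≠ j → P.Disj (x i) (x j)) : ‖∑ i ∈ s, x i‖ ^ q = ∑ i ∈ s, ‖x i‖ ^ q := by
  classical
  have hd : ∀ (s : Finset I) (j : I), j ∉ s → P.Disj (∑ i ∈ s, x i) (x j) := by
    intro s j hj
    induction s using Finset.induction_on with
    | empty => simpa using disj_zero_left _
    | insert i s hi ih =>
      rw [Finset.sum_insert hi]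
      simp only [Finset.mem_insert, not_or] at hj
      exact (h i j (Ne.symm hj.1)).add_left hq (ih hj.2)
  induction s using Finset.induction_on with
  | empty => simp [Real.zero_rpow hq.ne']
  | insert i s hi ih =>
    rw [Finset.sum_insert hi, Finset.sum_insert hi, ← ih, (hd s i hi).symm.norm_rpow_add hq]

/-- On A k the new term acts as c k • e and is absorbed into the scalar a; off A k it vanishes. This
removes one term from a sum at the cost of changing a and D. -/
theorem norm_rpow_proj_add_sum_insert {κ : Type*} [DecidableEq κ] {A : κ → Set Ω}
    (hA : ∀ k, MeasurableSet (A k)) (c : κ → ℂ) {s : Finset κ} {k : κ} (hk : k ∉ s) (a : ℂ)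
    {D : Set Ω} (hD : MeasurableSet D) (P : ProjSystem q Ω B) (e : B) :
    ‖P.proj D (a • e + ∑ k ∈ insert k s, c k • P.proj (A k) e)‖ ^ q =
      ‖P.proj (A k ∩ D) ((a + c k) • e + ∑ k ∈ s, c k • P.proj (A k) e)‖ ^ q +
      ‖P.proj ((A k)ᶜ ∩ D) (a • e + ∑ k ∈ s, c k • P.proj (A k) e)‖ ^ q := by
  rw [P.norm_rpow (hA k), ← P.proj_inter (hA k) hD, ← P.proj_inter (hA k).compl hD,
    Finset.sum_insert hk]
  congr 3
  · rw [add_smul, add_assoc, map_add, map_add, map_add, map_add, map_smul, map_smul,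
      P.proj_inter (hA k) hD (P.proj (A k) e), P.proj_comm hD (hA k),
      ← P.proj_inter (hA k) (hA k), Set.inter_self, ← P.proj_inter (hA k) hD, map_smul]
  · rw [map_add, map_add, map_add, map_smul _ (c k),
      P.proj_inter (hA k).compl hD (P.proj (A k) e), P.proj_comm hD (hA k),
      P.proj_compl_proj (hA k), smul_zero, zero_add]

/-- Terms with the same base vector lie in one cyclic subspace, and cyclic subspaces of disjoint
vectors consist of mutually disjoint vectors. -/
theorem norm_rpow_sum_smul_proj (hq : 0 < q) {I : Type*} [DecidableEq I] {e : I → B}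
    (hd : ∀ i j, i ≠ j → P.Disj (e i) (e j)) {κ : Type*} {A : κ → Set Ω}
    (hA : ∀ k, MeasurableSet (A k)) (r : κ → I) (c : κ → ℂ) (s : Finset κ) :
    ‖∑ k ∈ s, c k • P.proj (A k) (e (r k))‖ ^ q =
      ∑ i ∈ s.image r, ‖∑ k ∈ s with r k = i, c k • P.proj (A k) (e i)‖ ^ q := by
  have hm : ∀ i, ∑ k ∈ s with r k = i, c k • P.proj (A k) (e i) ∈ P.cyclic (e i) := fun i =>
    Submodule.sum_mem _ fun k _ => Submodule.smul_mem _ _ (Submodule.subset_span ⟨_, hA k, rfl⟩)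
  rw [← norm_rpow_sum (P := P) hq]
  · congr 2
    rw [← Finset.sum_fiberwise_of_maps_to (g := r) (t := s.image r)
      fun k hk => Finset.mem_image_of_mem _ hk]
    refine Finset.sum_congr rfl fun i _ => Finset.sum_congr rfl fun k hk => ?_
    rw [(Finset.mem_filter.1 hk).2]
  · intro i j hij
    exact (((hd i j hij).of_mem_cyclic_left hq (hm i)).symm.of_mem_cyclic_left hq (hm j)).symm

section Comparison

variable {B' : Type*} [NormedAddCommGroup B'] [NormedSpace ℂ B'] {P' : ProjSystem q Ω B'}

theorem norm_sum_smul_proj_eq (hq : 0 < q) {e : B} {e' : B'}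
    (h : ∀ A, MeasurableSet A → ‖P.proj A e‖ = ‖P'.proj A e'‖) {κ : Type*} {A : κ → Set Ω}
    (hA : ∀ k, MeasurableSet (A k)) (c : κ → ℂ) (s : Finset κ) :
    ‖∑ k ∈ s, c k • P.proj (A k) e‖ = ‖∑ k ∈ s, c k • P'.proj (A k) e'‖ := by
  classical
  -- The free scalar a and set D make the induction close, since removing a term alters both.
  have key : ∀ (s : Finset κ) (a : ℂ) (D : Set Ω), MeasurableSet D →
      ‖P.proj D (a • e + ∑ k ∈ s, c k • P.proj (A k) e)‖ =
        ‖P'.proj D (a • e' + ∑ k ∈ s, c k • P'.proj (A k) e')‖ := by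
    intro s
    induction s using Finset.induction_on with
    | empty => intro a D hD; simp [norm_smul, h D hD]
    | insert k s hk ih =>
      intro a D hD
      refine (Real.rpow_left_inj (norm_nonneg _) (norm_nonneg _) hq.ne').1 ?_
      rw [norm_rpow_proj_add_sum_insert hA c hk a hD, norm_rpow_proj_add_sum_insert hA c hk a hD,
        ih _ _ ((hA k).inter hD), ih _ _ ((hA k).compl.inter hD)]
  simpa [P.proj_univ, P'.proj_univ] using key s 0 Set.univ .univ

theorem norm_sum_sum_smul_proj_eq (hq : 0 < q) {I : Type*} {e : I → B} {e' : I → B'}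
    (hd : ∀ i j, i ≠ j → P.Disj (e i) (e j)) (hd' : ∀ i j, i ≠ j → P'.Disj (e' i) (e' j))
    (h : ∀ i A, MeasurableSet A → ‖P.proj A (e i)‖ = ‖P'.proj A (e' i)‖) {κ : Type*}
    {A : κ → Set Ω} (hA : ∀ k, MeasurableSet (A k)) (r : κ → I) (c : κ → ℂ) (s : Finset κ) :
    ‖∑ k ∈ s, c k • P.proj (A k) (e (r k))‖ = ‖∑ k ∈ s, c k • P'.proj (A k) (e' (r k))‖ := by
  classical
  refine (Real.rpow_left_inj (norm_nonneg _) (norm_nonneg _) hq.ne').1 ?_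
  rw [norm_rpow_sum_smul_proj hq hd hA, norm_rpow_sum_smul_proj hq hd' hA]
  exact Finset.sum_congr rfl fun i _ => by rw [norm_sum_smul_proj_eq hq (h i) hA]

end Comparison

end ProjSystem

/-! ### Multiplicity-free systems and maximal disjoint families -/

namespace ProjSystem

variable {q : ℝ} {Ω : Type*} [MeasurableSpace Ω] {B : Type*} [NormedAddCommGroup B]
  [NormedSpace ℂ B] (P : ProjSystem q Ω B)

/-- The closed span of the images of the vectors of `S` under the projections. -/
def band (S : Set B) : Submodule ℂ B :=
  (Submodule.span ℂ {b | ∃ e ∈ S, ∃ A : Set Ω, MeasurableSet A ∧ P.proj A e = b}).topologicalClosure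

variable {P}

theorem proj_mem_band (hq : 0 < q) {S : Set B} {D : Set Ω} (hD : MeasurableSet D) {b : B}
    (hb : b ∈ P.band S) : P.proj D b ∈ P.band S := by
  refine map_mem_closure (P.continuous_proj hq hD) hb fun x hx => ?_
  induction hx using Submodule.span_induction with
  | mem x hx =>
    obtain ⟨e, he, A, hA, rfl⟩ := hx
    exact Submodule.subset_span ⟨e, he, D ∩ A, hD.inter hA, P.proj_inter hD hA e⟩
  | zero => rw [map_zero]; exact Submodule.zero_mem _
  | add x y _ _ h1 h2 => rw [map_add]; exact Submodule.add_mem _ h1 h2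
  | smul c x _ h1 => rw [map_smul]; exact Submodule.smul_mem _ c h1

theorem closure_cyclic_le_band {S : Set B} {e : B} (he : e ∈ S) :
    (P.cyclic e).topologicalClosure ≤ P.band S :=
  Submodule.topologicalClosure_mono (Submodule.span_mono fun _ ⟨A, hA, h⟩ => ⟨e, he, A, hA, h⟩)

/-- The set of measurable sets outside of which `b` is carried by the band of `S`. -/
def Carrier (P : ProjSystem q Ω B) (S : Set B) (b : B) (D : Set Ω) : Prop :=
  MeasurableSet D ∧ P.proj Dᶜ b ∈ P.band S

theorem Carrier.inter (hq : 0 < q) {S : Set B} {b : B} {D D' : Set Ω} (h : P.Carrier S b D)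
    (h' : P.Carrier S b D') : P.Carrier S b (D ∩ D') := by
  refine ⟨h.1.inter h'.1, ?_⟩
  have : (D ∩ D')ᶜ = Dᶜ ∪ (D ∩ D'ᶜ) := by ext; simp; tauto
  rw [this, P.proj_union h.1.compl (h.1.inter h'.1.compl)
    (Set.disjoint_left.2 fun a ha hb => ha hb.1), P.proj_inter h.1 h'.1.compl]
  exact Submodule.add_mem _ h.2 (proj_mem_band hq h.1 h'.2)

theorem norm_rpow_proj_diff {A D : Set Ω} (hA : MeasurableSet A) (hD : MeasurableSet D) (b : B) :
    ‖P.proj A b‖ ^ q = ‖P.proj (A ∩ D) b‖ ^ q + ‖P.proj (A \ D) b‖ ^ q := by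
  rw [P.norm_rpow hD, ← P.proj_inter hD hA, ← P.proj_inter hD.compl hA, Set.inter_comm D,
    Set.inter_comm Dᶜ, ← Set.sdiff_eq]

theorem proj_sub_proj {A D : Set Ω} (hA : MeasurableSet A) (hD : MeasurableSet D) (b : B) :
    P.proj A b - P.proj D b = P.proj (A \ D) b - P.proj (D \ A) b := by
  have h1 : P.proj A b = P.proj (A ∩ D) b + P.proj (A \ D) b := by
    rw [← P.proj_union (hA.inter hD) (hA.diff hD) Set.disjoint_sdiff_inter.symm,
      Set.inter_union_sdiff]
  have h2 : P.proj D b = P.proj (A ∩ D) b + P.proj (D \ A) b := by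
    rw [Set.inter_comm, ← P.proj_union (hD.inter hA) (hD.diff hA) Set.disjoint_sdiff_inter.symm,
      Set.inter_union_sdiff]
  rw [h1, h2]; abel

/-- `P` is multiplicity free if every vector is, up to a small part of `e`, in the closed cyclic
subspace generated by `e`. -/
def MultiplicityFree (P : ProjSystem q Ω B) : Prop :=
  ∀ (b e : B) (ε : ℝ), 0 < ε → ∃ A : Set Ω, MeasurableSet A ∧
    P.proj A b ∈ (P.cyclic e).topologicalClosure ∧ ‖P.proj Aᶜ e‖ ≤ ε

/-- From a vector b outside the band, cut away as much as the band can absorb: minimise ‖P_D b‖^q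
over the sets D with P_{Dᶜ} b in the band. The limit x of the minimising P_D b is what is left. -/
theorem MultiplicityFree.exists_disj [CompleteSpace B] (hP : P.MultiplicityFree) (hq : 0 < q)
    {S : Set B} (hS : P.band S ≠ ⊤) : ∃ x : B, x ≠ 0 ∧ ∀ e ∈ S, P.Disj x e := by
  obtain ⟨b, hb⟩ : ∃ b, b ∉ P.band S := by
    by_contra! h
    exact hS (eq_top_iff.2 fun b _ => h b)
  set T : Set ℝ := {t | ∃ D, P.Carrier S b D ∧ ‖P.proj D b‖ ^ q = t} with hT
  have hTne : T.Nonempty :=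
    ⟨_, Set.univ, ⟨.univ, by rw [Set.compl_univ, P.proj_empty]; exact Submodule.zero_mem _⟩, rfl⟩
  have hTbdd : BddBelow T := ⟨0, by rintro t ⟨D, _, rfl⟩; positivity⟩
  have hle : ∀ D, P.Carrier S b D → sInf T ≤ ‖P.proj D b‖ ^ q := fun D hD =>
    csInf_le hTbdd ⟨D, hD, rfl⟩
  have hex : ∀ n : ℕ, ∃ D, P.Carrier S b D ∧ ‖P.proj D b‖ ^ q < sInf T + 1 / (n + 1) := by
    intro n
    obtain ⟨t, ⟨D, hD, rfl⟩, ht⟩ := exists_lt_of_csInf_lt hTne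
      (show sInf T < sInf T + 1 / ((n : ℝ) + 1) by linarith [Nat.one_div_pos_of_nat (α := ℝ) (n := n)])
    exact ⟨D, hD, ht⟩
  choose D hD hDlt using hex
  -- D n ∩ E is again admissible, so its share is at least the infimum, and D n \ E carries at most
  -- the excess 1/(n+1).
  have hsmall : ∀ n E, P.Carrier S b E → ‖P.proj (D n \ E) b‖ ≤ (1 / ((n : ℝ) + 1)) ^ q⁻¹ := by
    intro n E hE
    have h1 := norm_rpow_proj_diff (P := P) (hD n).1 hE.1 b
    have h2 := hle _ ((hD n).inter hq hE)
    have h3 := hDlt n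
    rw [Real.le_rpow_inv_iff_of_pos (norm_nonneg _) (by positivity) hq]
    linarith
  have hlim : Tendsto (fun n : ℕ => (1 / ((n : ℝ) + 1)) ^ q⁻¹) atTop (𝓝 0) := by
    have := (tendsto_one_div_add_atTop_nhds_zero_nat (𝕜 := ℝ)).rpow_const
      (p := q⁻¹) (.inr (inv_nonneg.2 hq.le))
    rwa [Real.zero_rpow (inv_ne_zero hq.ne')] at this
  have hanti : ∀ {n m : ℕ}, n ≤ m → (1 / ((m : ℝ) + 1)) ^ q⁻¹ ≤ (1 / ((n : ℝ) + 1)) ^ q⁻¹ :=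
    fun h => Real.rpow_le_rpow (by positivity) (Nat.one_div_le_one_div h) (inv_nonneg.2 hq.le)
  have hcauchy : CauchySeq fun n => P.proj (D n) b := by
    refine cauchySeq_of_le_tendsto_0 (fun n => (1 / ((n : ℝ) + 1)) ^ q⁻¹ + (1 / ((n : ℝ) + 1)) ^ q⁻¹)
      (fun n m N hn hm => ?_) (by simpa using hlim.add hlim)
    rw [dist_eq_norm, proj_sub_proj (hD n).1 (hD m).1]
    exact (norm_sub_le _ _).trans (add_le_add ((hsmall n _ (hD m)).trans (hanti hn))
      ((hsmall m _ (hD n)).trans (hanti hm)))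
  obtain ⟨x, hx⟩ := cauchySeq_tendsto_of_complete hcauchy
  have hbx : b - x ∈ P.band S := by
    refine (Submodule.isClosed_topologicalClosure _).mem_of_tendsto (hx.const_sub b)
      (Eventually.of_forall fun n => ?_)
    rw [sub_eq_of_eq_add' (P.proj_add_compl (hD n).1 b).symm]
    exact (hD n).2
  refine ⟨x, ?_, fun e he => ?_⟩
  · rintro rfl
    rw [sub_zero] at hbx
    exact hb hbx
  · have hA : ∀ n : ℕ, ∃ A : Set Ω, MeasurableSet A ∧
        P.proj A b ∈ (P.cyclic e).topologicalClosure ∧ ‖P.proj Aᶜ e‖ ≤ 1 / (n + 1) :=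
      fun n => hP b e _ Nat.one_div_pos_of_nat
    choose A hA hAb hAe using hA
    refine ⟨A, hA, ?_, squeeze_zero_norm hAe tendsto_one_div_add_atTop_nhds_zero_nat⟩
    -- The part of b on A n lies in the band, so (A n)ᶜ is admissible and D m ∩ A n carries less and
    -- less of b as m grows.
    have h0 : ∀ n, P.proj (A n) x = 0 := by
      intro n
      have h1 := ((P.continuous_proj hq (hA n)).tendsto x).comp hx
      have h2 : P.Carrier S b (A n)ᶜ :=
        ⟨(hA n).compl, by rw [compl_compl]; exact closure_cyclic_le_band he (hAb n)⟩
      refine tendsto_nhds_unique h1 (squeeze_zero_norm (fun m => ?_) hlim)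
      have h3 := hsmall m _ h2
      rwa [Set.sdiff_compl, Set.inter_comm, P.proj_inter (hA n) (hD m).1] at h3
    simp [h0]

/-- If a maximal disjoint family did not generate the space, a nonzero vector disjoint from all of
it could be adjoined; by maximality it is already a member, hence disjoint from itself, hence zero.
-/
theorem MultiplicityFree.exists_pairwise_disj [CompleteSpace B] (hP : P.MultiplicityFree)
    (hq : 0 < q) : ∃ S : Set B, S.Pairwise P.Disj ∧ P.band S = ⊤ := by
  obtain ⟨S, hS⟩ := zorn_subset {S : Set B | S.Pairwise P.Disj} fun c hc hch =>
    ⟨⋃₀ c, (Set.pairwise_sUnion hch.directedOn).2 hc, fun s hs => Set.subset_sUnion_of_mem hs⟩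
  refine ⟨S, hS.prop, by_contra fun hne => ?_⟩
  obtain ⟨x, hx0, hx⟩ := hP.exists_disj hq hne
  have hins : (insert x S).Pairwise P.Disj :=
    hS.prop.insert fun e he _ => ⟨hx e he, (hx e he).symm⟩
  have hxS : x ∈ S := hS.le_of_ge hins (Set.subset_insert x S) (Set.mem_insert x S)
  exact hx0 (hx x hxS).eq_zero

end ProjSystem

/-- Two linear maps with dense ranges and `‖T v‖ = ‖T' v‖` induce an isometric isomorphism. -/
theorem exists_linearIsometryEquiv_of_norm_eq {V Y B : Type*} [AddCommGroup V] [Module ℂ V]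
    [NormedAddCommGroup Y] [NormedSpace ℂ Y] [CompleteSpace Y] [NormedAddCommGroup B]
    [NormedSpace ℂ B] [CompleteSpace B] (T : V →ₗ[ℂ] Y) (T' : V →ₗ[ℂ] B) (hT : DenseRange T)
    (hT' : DenseRange T') (h : ∀ v, ‖T v‖ = ‖T' v‖) : ∃ S : Y ≃ₗᵢ[ℂ] B, ∀ v, S (T v) = T' v := by
  have h1 : ∀ v, T'.extendOfNorm T (T v) = T' v :=
    LinearMap.extendOfNorm_eq hT ⟨1, fun v => by rw [h, one_mul]⟩
  have h2 : ∀ v, T.extendOfNorm T' (T' v) = T v :=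
    LinearMap.extendOfNorm_eq hT' ⟨1, fun v => by rw [h, one_mul]⟩
  have h3 : ∀ y, T.extendOfNorm T' (T'.extendOfNorm T y) = y := fun y =>
    hT.induction_on y (isClosed_eq (by fun_prop) continuous_id) fun v => by rw [h1, h2]
  have h4 : ∀ y, T'.extendOfNorm T (T.extendOfNorm T' y) = y := fun y =>
    hT'.induction_on y (isClosed_eq (by fun_prop) continuous_id) fun v => by rw [h2, h1]
  have h5 : ∀ y, ‖T'.extendOfNorm T y‖ = ‖y‖ := fun y =>
    hT.induction_on y (isClosed_eq (by fun_prop) continuous_norm) fun v => by rw [h1, h]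
  exact ⟨⟨LinearEquiv.ofLinearMap (T'.extendOfNorm T).toLinearMap (T.extendOfNorm T').toLinearMap
    (LinearMap.ext h4) (LinearMap.ext h3), h5⟩, h1⟩

/-- Pull back a system of projections along a Boolean homomorphism of set algebras. -/
def ProjSystem.comap {q : ℝ} {Ω Z : Type*} [MeasurableSpace Ω] [MeasurableSpace Z] {B : Type*}
    [NormedAddCommGroup B] [NormedSpace ℂ B] (P : ProjSystem q Z B) (φ : Set Ω → Set Z)
    (hm : ∀ A, MeasurableSet A → MeasurableSet (φ A)) (hu : φ Set.univ = Set.univ)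
    (hi : ∀ A D, φ (A ∩ D) = φ A ∩ φ D) (hc : ∀ A, φ Aᶜ = (φ A)ᶜ) : ProjSystem q Ω B where
  proj A := P.proj (φ A)
  proj_univ b := by rw [hu, P.proj_univ]
  proj_inter hA hD b := by rw [hi, P.proj_inter (hm _ hA) (hm _ hD)]
  proj_union {A D} hA hD h b := by
    have h1 : φ (A ∪ D) = φ A ∪ φ D := by
      rw [← compl_compl (A ∪ D), hc, Set.compl_union, hi, hc, hc, Set.compl_inter, compl_compl,
        compl_compl]
    have h2 : Disjoint (φ A) (φ D) := by
      have h3 : φ ∅ = ∅ := by rw [← Set.compl_univ, hc, hu, Set.compl_univ]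
      rw [Set.disjoint_iff_inter_eq_empty, ← hi, Set.disjoint_iff_inter_eq_empty.1 h, h3]
    rw [h1, P.proj_union (hm _ hA) (hm _ hD) h2]
  norm_rpow {A} hA b := by rw [hc, P.norm_rpow (hm _ hA)]

/-! ### Multiplication by indicator functions on L^p -/

section LpSystem

variable {Z : Type*} [MeasurableSpace Z] {m : Measure Z} {p : ℝ≥0∞}

theorem Lp_norm_rpow_eq (hp : p ≠ 0) (hp' : p ≠ ∞) (f : Lp ℂ p m) :
    ‖f‖ ^ p.toReal = (∫⁻ x, ‖f x‖ₑ ^ p.toReal ∂m).toReal := by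
  rw [Lp.norm_def, eLpNorm_eq_lintegral_rpow_enorm_toReal hp hp', ENNReal.toReal_rpow,
    ← ENNReal.rpow_mul, one_div, inv_mul_cancel₀ (ENNReal.toReal_pos hp hp').ne', ENNReal.rpow_one]

theorem Lp_lintegral_rpow_ne_top (hp : p ≠ 0) (hp' : p ≠ ∞) (f : Lp ℂ p m) :
    ∫⁻ x, ‖f x‖ₑ ^ p.toReal ∂m ≠ ∞ :=
  (lintegral_rpow_enorm_lt_top_of_eLpNorm_lt_top hp hp' (Lp.eLpNorm_lt_top f)).ne

open Classical in
/-- Multiplication by the indicator function of a (measurable) set, on `L^p`. -/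
noncomputable def Lp.indicatorₗ (p : ℝ≥0∞) (m : Measure Z) (A : Set Z) : Lp ℂ p m →ₗ[ℂ] Lp ℂ p m :=
  if hA : MeasurableSet A then
    { toFun := fun f => ((Lp.memLp f).indicator hA).toLp (A.indicator f)
      map_add' := fun f g => by
        rw [← MemLp.toLp_add]
        refine (MemLp.toLp_eq_toLp_iff _ _).2 ?_
        rw [← Set.indicator_add']
        filter_upwards [Lp.coeFn_add f g] with x hx
        by_cases h : x ∈ A
        · rw [Set.indicator_of_mem h, Set.indicator_of_mem h, hx]
        · rw [Set.indicator_of_notMem h, Set.indicator_of_notMem h]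
      map_smul' := fun c f => by
        rw [RingHom.id_apply, ← MemLp.toLp_const_smul]
        refine (MemLp.toLp_eq_toLp_iff _ _).2 ?_
        filter_upwards [Lp.coeFn_smul c f] with x hx
        by_cases h : x ∈ A
        · rw [Set.indicator_of_mem h, hx, Pi.smul_apply, Pi.smul_apply, Set.indicator_of_mem h]
        · simp [h] }
  else 0

theorem Lp.indicatorₗ_apply {A : Set Z} (hA : MeasurableSet A) (f : Lp ℂ p m) :
    Lp.indicatorₗ p m A f = ((Lp.memLp f).indicator hA).toLp (A.indicator f) := by
  simp only [Lp.indicatorₗ, dif_pos hA, LinearMap.coe_mk, AddHom.coe_mk]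

theorem Lp.coeFn_indicatorₗ {A : Set Z} (hA : MeasurableSet A) (f : Lp ℂ p m) :
    Lp.indicatorₗ p m A f =ᵐ[m] A.indicator f := by
  rw [Lp.indicatorₗ_apply hA]
  have h : MemLp (A.indicator f) p m := (Lp.memLp f).indicator hA
  exact h.coeFn_toLp

/-- The system of multiplications by indicator functions on `L^p`. -/
noncomputable def LpSystem (hp : p ≠ 0) (hp' : p ≠ ∞) [Fact (1 ≤ p)] :
    ProjSystem p.toReal Z (Lp ℂ p m) where
  proj := Lp.indicatorₗ p m
  proj_univ f := by
    refine Lp.ext ?_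
    filter_upwards [Lp.coeFn_indicatorₗ MeasurableSet.univ f] with x hx
    rw [hx, Set.indicator_univ]
  proj_inter {A D} hA hD f := by
    refine Lp.ext ?_
    filter_upwards [Lp.coeFn_indicatorₗ (hA.inter hD) f, Lp.coeFn_indicatorₗ hD f,
      Lp.coeFn_indicatorₗ hA (Lp.indicatorₗ p m D f)] with x h1 h2 h3
    rw [h1, h3]
    by_cases h : x ∈ A <;> by_cases h' : x ∈ D <;> simp [h, h', h2]
  proj_union {A D} hA hD hd f := by
    refine Lp.ext ?_
    filter_upwards [Lp.coeFn_indicatorₗ (hA.union hD) f, Lp.coeFn_indicatorₗ hD f,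
      Lp.coeFn_indicatorₗ hA f,
      Lp.coeFn_add (Lp.indicatorₗ p m A f) (Lp.indicatorₗ p m D f)] with x h1 h2 h3 h4
    rw [h1, h4, Pi.add_apply, h2, h3, Set.indicator_union_of_disjoint hd]
  norm_rpow {A} hA f := by
    have hq : 0 < p.toReal := ENNReal.toReal_pos hp hp'
    have key : ∀ A : Set Z, MeasurableSet A →
        ∫⁻ x, ‖Lp.indicatorₗ p m A f x‖ₑ ^ p.toReal ∂m = ∫⁻ x in A, ‖f x‖ₑ ^ p.toReal ∂m := by
      intro A hA
      rw [← lintegral_indicator hA]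
      refine lintegral_congr_ae ?_
      filter_upwards [Lp.coeFn_indicatorₗ hA f] with x hx
      by_cases h : x ∈ A <;> simp [h, hx, hq]
    rw [Lp_norm_rpow_eq hp hp', Lp_norm_rpow_eq hp hp', Lp_norm_rpow_eq hp hp', key A hA,
      key Aᶜ hA.compl, ← lintegral_add_compl _ hA, ENNReal.toReal_add]
    · exact ((setLIntegral_le_lintegral _ _).trans_lt (Lp_lintegral_rpow_ne_top hp hp' f).lt_top).ne
    · exact ((setLIntegral_le_lintegral _ _).trans_lt (Lp_lintegral_rpow_ne_top hp hp' f).lt_top).ne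

theorem Lp.indicatorₗ_indicatorConstLp {A s : Set Z} (hA : MeasurableSet A)
    (hs : MeasurableSet s) (hms : m s ≠ ∞) (c : ℂ) :
    Lp.indicatorₗ p m A (indicatorConstLp p hs hms c) =
      indicatorConstLp p (hA.inter hs) (measure_ne_top_of_subset Set.inter_subset_right hms) c := by
  refine Lp.ext ?_
  filter_upwards [Lp.coeFn_indicatorₗ hA (indicatorConstLp p hs hms c),
    indicatorConstLp_coeFn (p := p) (hs := hs) (hμs := hms) (c := c),
    indicatorConstLp_coeFn (p := p) (hs := hA.inter hs)
      (hμs := measure_ne_top_of_subset Set.inter_subset_right hms) (c := c)] with x h1 h2 h3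
  rw [h1, h3]
  by_cases h : x ∈ A <;> by_cases h' : x ∈ s <;> simp [h, h', h2]

end LpSystem

/-! ### From finitely additive set functions to measures on the Stone space -/

section Stone

variable {q : ℝ} {Ω : Type*} [MeasurableSpace Ω] {B : Type*} [NormedAddCommGroup B]
  [NormedSpace ℂ B]

/-- The clopen set of ultrafilters containing `A`. -/
def stoneSet {Ω : Type*} (A : Set Ω) : Set (Ultrafilter Ω) := {u | A ∈ u}

theorem stoneSet_univ {Ω : Type*} : stoneSet (Set.univ : Set Ω) = Set.univ :=
  Set.eq_univ_of_forall fun u => (univ_mem : Set.univ ∈ (u : Filter Ω))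

theorem stoneSet_inter {Ω : Type*} (A D : Set Ω) :
    stoneSet (A ∩ D) = stoneSet A ∩ stoneSet D :=
  Set.ext fun u => (inter_mem_iff : A ∩ D ∈ (u : Filter Ω) ↔ _)

theorem stoneSet_compl {Ω : Type*} (A : Set Ω) : stoneSet Aᶜ = (stoneSet A)ᶜ := by
  ext u; simp [stoneSet, Ultrafilter.compl_mem_iff_notMem]

theorem stoneSet_injective {Ω : Type*} : Function.Injective (stoneSet (Ω := Ω)) := by
  intro A D h
  ext x
  have := Set.ext_iff.1 h (pure x)
  simpa [stoneSet] using this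

/-- The algebra of clopen sets coming from measurable sets. -/
def stoneAlgebra (Ω : Type*) [MeasurableSpace Ω] : Set (Set (Ultrafilter Ω)) :=
  {s | ∃ A : Set Ω, MeasurableSet A ∧ stoneSet A = s}

theorem isSetAlgebra_stoneAlgebra : IsSetAlgebra (stoneAlgebra Ω) where
  empty_mem := ⟨∅, .empty, by rw [← Set.compl_univ, stoneSet_compl, stoneSet_univ]; simp⟩
  compl_mem := by rintro _ ⟨A, hA, rfl⟩; exact ⟨Aᶜ, hA.compl, stoneSet_compl A⟩
  union_mem := by
    rintro _ _ ⟨A, hA, rfl⟩ ⟨D, hD, rfl⟩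
    refine ⟨A ∪ D, hA.union hD, ?_⟩
    rw [← compl_inj_iff, ← stoneSet_compl, Set.compl_union, stoneSet_inter, stoneSet_compl,
      stoneSet_compl, Set.compl_union]

/-- The `σ`-algebra on the Stone space generated by the clopen sets of measurable sets. -/
abbrev stoneSigma (Ω : Type*) [MeasurableSpace Ω] : MeasurableSpace (Ultrafilter Ω) :=
  .generateFrom (stoneAlgebra Ω)

/-- The set function A ↦ ‖P_A e‖^q need only be finitely additive on Ω. Its copy on clopen sets is
countably subadditive by compactness, as a countable cover of a clopen set by clopen sets has a
finite subcover, so it extends to a measure. -/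
theorem exists_stone_measure (P : ProjSystem q Ω B) (hq : 0 < q) (e : B) :
    ∃ ν : @Measure (Ultrafilter Ω) (stoneSigma Ω), ∀ A : Set Ω, MeasurableSet A →
      ν (stoneSet A) = ENNReal.ofReal (‖P.proj A e‖ ^ q) := by
  let : MeasurableSpace (Ultrafilter Ω) := stoneSigma Ω
  have hR : IsSetRing (stoneAlgebra Ω) := isSetAlgebra_stoneAlgebra.isSetRing
  -- As `stoneSet` is injective, the preimage of `{stoneSet A}` is `{A}` and its union recovers A.
  let f : Set (Ultrafilter Ω) → ℝ≥0∞ := fun s =>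
    ENNReal.ofReal (‖P.proj (stoneSet ⁻¹' {s} : Set (Set Ω)).sUnion e‖ ^ q)
  have hf : ∀ A : Set Ω, f (stoneSet A) = ENNReal.ofReal (‖P.proj A e‖ ^ q) := by
    intro A
    have : (stoneSet ⁻¹' {stoneSet A} : Set (Set Ω)) = {A} := by
      ext D; simp [stoneSet_injective.eq_iff]
    simp only [f, this, Set.sUnion_singleton]
  have h0 : stoneSet (∅ : Set Ω) = ∅ := by
    rw [← Set.compl_univ, stoneSet_compl, stoneSet_univ, Set.compl_univ]
  have hunion : ∀ A D : Set Ω, stoneSet (A ∪ D) = stoneSet A ∪ stoneSet D := fun A D => by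
    ext u; simp [stoneSet]
  let c : AddContent ℝ≥0∞ (stoneAlgebra Ω) := hR.addContent_of_union f
    (by rw [← h0, hf, P.proj_empty]; simp [Real.zero_rpow hq.ne'])
    (by
      rintro _ _ ⟨A, hA, rfl⟩ ⟨D, hD, rfl⟩ hd
      have hd' : Disjoint A D := by
        rw [Set.disjoint_iff_inter_eq_empty] at hd ⊢
        rw [← stoneSet_inter, ← h0] at hd
        exact stoneSet_injective hd
      rw [← hunion, hf, hf, hf, ← ENNReal.ofReal_add (by positivity) (by positivity),
        P.norm_rpow hA, ← P.proj_inter hA (hA.union hD), ← P.proj_inter hA.compl (hA.union hD)]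
      have h1 : A ∩ (A ∪ D) = A := by simp
      have h2 : Aᶜ ∩ (A ∪ D) = D := by
        rw [Set.inter_union_distrib_left, Set.compl_inter_self, Set.empty_union]
        exact Set.inter_eq_self_of_subset_right hd'.subset_compl_left
      rw [h1, h2])
  have hc : ∀ s, c s = f s := fun s => rfl
  have hsub : c.IsSigmaSubadditive := by
    intro g hg hU
    have hopen : ∀ i, IsOpen (g i) := fun i => by
      obtain ⟨A, -, hA⟩ := hg i
      rw [← hA]; exact ultrafilter_isOpen_basic A
    have hcomp : IsCompact (⋃ i, g i) := by
      obtain ⟨A, -, hA⟩ := hU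
      rw [← hA]; exact (ultrafilter_isClosed_basic A).isCompact
    obtain ⟨t, ht⟩ := hcomp.elim_finite_subcover g hopen subset_rfl
    have : (⋃ i, g i) = ⋃ i ∈ t, g i := subset_antisymm ht (Set.iUnion₂_subset_iUnion _ _)
    rw [this]
    exact (addContent_biUnion_le hR fun i _ => hg i).trans (ENNReal.sum_le_tsum t)
  refine ⟨c.measure hR.isSetSemiring le_rfl hsub, fun A hA => ?_⟩
  rw [c.measure_eq hR.isSetSemiring rfl hsub ⟨A, hA, rfl⟩, hc, hf]

end Stone

/-! ### Disjoint sums of measures and dense families of sets -/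

section SumMeasure

variable {I K : Type*} [MeasurableSpace K]

/-- The disjoint union of a family of measures, as a measure on a product space. -/
noncomputable def sumMeasure [MeasurableSpace I] (ν : I → Measure K) : Measure (I × K) :=
  Measure.sum fun i => (ν i).map (Prod.mk i)

theorem sumMeasure_apply [MeasurableSpace I] (ν : I → Measure K) {s : Set (I × K)}
    (hs : MeasurableSet s) : sumMeasure ν s = ∑' i, ν i (Prod.mk i ⁻¹' s) := by
  rw [sumMeasure, Measure.sum_apply _ hs]
  exact tsum_congr fun i => Measure.map_apply measurable_prodMk_left hs

theorem sumMeasure_singleton_prod [MeasurableSpace I] [MeasurableSingletonClass I]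
    (ν : I → Measure K) (i : I) {s : Set K}
    (hs : MeasurableSet s) : sumMeasure ν ({i} ×ˢ s) = ν i s := by
  rw [sumMeasure_apply ν ((measurableSet_singleton i).prod hs), tsum_eq_single i]
  · congr 1; ext; simp
  · intro j hj
    have : Prod.mk j ⁻¹' ({i} ×ˢ s) = ∅ := by ext; simp [hj]
    rw [this, measure_empty]

/-- A set of finite measure has all but ε/2 of its mass on finitely many slices, and these are
approximated one by one with total error ε/2. -/
theorem exists_measure_symmDiff_biUnion_lt [MeasurableSpace I] [MeasurableSingletonClass I]
    {ν : I → Measure K} {𝒜 : Set (Set K)} (h : ∀ i, (ν i).MeasureDense 𝒜) {s : Set (I × K)}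
    (hs : MeasurableSet s) (hνs : sumMeasure ν s ≠ ∞) {ε : ℝ} (hε : 0 < ε) :
    ∃ (F : Finset I) (A : I → Set K), (∀ i, A i ∈ 𝒜) ∧
      sumMeasure ν (s ∆ ⋃ i ∈ F, {i} ×ˢ A i) < ENNReal.ofReal ε := by
  have hsum := hνs
  rw [sumMeasure_apply ν hs] at hsum
  have hε2 : (0 : ℝ≥0∞) < ENNReal.ofReal (ε / 2) := ENNReal.ofReal_pos.2 (by positivity)
  obtain ⟨F, hF⟩ := ((tendsto_order.1 (ENNReal.tendsto_tsum_compl_atTop_zero hsum)).2 _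
    hε2).exists
  have hsi : ∀ i, MeasurableSet (Prod.mk i ⁻¹' s) := fun i => measurable_prodMk_left hs
  have hfin : ∀ i, ν i (Prod.mk i ⁻¹' s) ≠ ∞ := fun i =>
    ne_top_of_le_ne_top hsum (ENNReal.le_tsum i)
  -- The + 1 covers the case of empty F.
  have hδ : 0 < ε / 2 / (F.card + 1) := by positivity
  choose A hA hAs using fun i => (h i).approx _ (hsi i) (hfin i) _ hδ
  refine ⟨F, A, hA, ?_⟩
  have hm : MeasurableSet (⋃ i ∈ F, ({i} : Set I) ×ˢ A i) :=
    F.measurableSet_biUnion fun i _ =>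
      (measurableSet_singleton i).prod ((h i).measurable _ (hA i))
  set t := ⋃ i ∈ F, ({i} : Set I) ×ˢ A i with ht
  have h1 : ∀ i ∈ F, ν i (Prod.mk i ⁻¹' (s ∆ t)) ≤ ENNReal.ofReal (ε / 2 / (F.card + 1)) := by
    intro i hi
    have : Prod.mk i ⁻¹' (s ∆ t) = (Prod.mk i ⁻¹' s) ∆ A i := by
      ext x; simp [ht, Set.mem_symmDiff, hi]
    rw [this]
    exact (hAs i).le
  have h2 : ∀ i : {i // i ∉ F}, ν i (Prod.mk (i : I) ⁻¹' (s ∆ t)) =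
      ν i (Prod.mk (i : I) ⁻¹' s) := by
    rintro ⟨i, hi⟩
    have : Prod.mk i ⁻¹' (s ∆ t) = Prod.mk i ⁻¹' s := by
      ext x; simp [ht, Set.mem_symmDiff, hi]
    rw [this]
  have h3 : ∑ i ∈ F, ν i (Prod.mk i ⁻¹' (s ∆ t)) ≤ ENNReal.ofReal (ε / 2) := by
    refine (Finset.sum_le_sum h1).trans ?_
    rw [Finset.sum_const, ← ENNReal.ofReal_nsmul]
    refine ENNReal.ofReal_le_ofReal ?_
    rw [nsmul_eq_mul, mul_div_assoc', div_le_iff₀ (by positivity), mul_comm]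
    exact mul_le_mul_of_nonneg_left (by linarith) (by positivity)
  have h4 : ∑' i : {i // i ∉ F}, ν i (Prod.mk (i : I) ⁻¹' (s ∆ t)) < ENNReal.ofReal (ε / 2) := by
    rw [tsum_congr h2]; exact hF
  have h5 := ENNReal.add_lt_add_of_le_of_lt (ne_top_of_le_ne_top ENNReal.ofReal_ne_top h3) h3 h4
  rw [← ENNReal.ofReal_add (by positivity) (by positivity), add_halves] at h5
  rw [sumMeasure_apply ν (hs.symmDiff hm)]
  rw [← F.tsum_subtype'] at h5
  rw [← ENNReal.summable.tsum_add_tsum_compl (s := (F : Set I)) ENNReal.summable]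
  exact h5

theorem measureDense_sumMeasure [MeasurableSpace I] [MeasurableSingletonClass I]
    {ν : I → Measure K} {𝒜 : Set (Set K)} (h : ∀ i, (ν i).MeasureDense 𝒜) :
    (sumMeasure ν).MeasureDense
      {t | ∃ (F : Finset I) (A : I → Set K), (∀ i, A i ∈ 𝒜) ∧ t = ⋃ i ∈ F, {i} ×ˢ A i} where
  measurable := by
    rintro _ ⟨F, A, hA, rfl⟩
    exact F.measurableSet_biUnion fun i _ =>
      (measurableSet_singleton i).prod ((h i).measurable _ (hA i))
  approx s hs hνs ε hε := by
    obtain ⟨F, A, hA, hlt⟩ := exists_measure_symmDiff_biUnion_lt h hs hνs hε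
    exact ⟨_, ⟨F, A, hA, rfl⟩, hlt⟩

/-- The indicator functions of the members of a measure dense family of sets span a dense
subspace. -/
theorem Lp_mem_of_measureDense {Z : Type*} [MeasurableSpace Z] {m : Measure Z} {p : ℝ≥0∞}
    [Fact (1 ≤ p)] (hp : p ≠ ∞) {𝒜 : Set (Set Z)} (h : m.MeasureDense 𝒜)
    {M : Submodule ℂ (Lp ℂ p m)} (hM : IsClosed (M : Set (Lp ℂ p m)))
    (hind : ∀ s (hs : s ∈ 𝒜) (hms : m s ≠ ∞) (c : ℂ),
      indicatorConstLp p (h.measurable s hs) hms c ∈ M) (f : Lp ℂ p m) : f ∈ M := by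
  have : Fact (p ≠ ∞) := ⟨hp⟩
  refine Lp.induction hp (fun f => f ∈ M) (fun c s hs hms => ?_)
    (fun f g hf hg _ h1 h2 => M.add_mem h1 h2) hM f
  rw [Lp.simpleFunc.coe_indicatorConst]
  have := h.indicatorConstLp_subset_closure p c ⟨s, hs, hms.ne, rfl⟩
  refine closure_minimal ?_ hM this
  rintro _ ⟨s, hs, hms, rfl⟩
  exact hind s hs hms c

end SumMeasure

/-! ### Multiplicity-free systems live on L^p-spaces -/

theorem ProjSystem.MultiplicityFree.exists_linearIsometryEquiv_Lp {p : ℝ≥0∞} [Fact (1 ≤ p)]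
    (hp : p ≠ ∞) {Ω : Type u} [MeasurableSpace Ω] {B : Type v} [NormedAddCommGroup B]
    [NormedSpace ℂ B] [CompleteSpace B] {P : ProjSystem p.toReal Ω B} (hP : P.MultiplicityFree) :
    ∃ (X : Type (max u v)) (_ : MeasurableSpace X) (ν : Measure X),
      Nonempty (B ≃ₗᵢ[ℂ] Lp ℂ p ν) := by
  have hp0 : p ≠ 0 := (zero_lt_one.trans_le (Fact.out : 1 ≤ p)).ne'
  have hq : 0 < p.toReal := ENNReal.toReal_pos hp0 hp
  obtain ⟨S, hS, hband⟩ := hP.exists_pairwise_disj hq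
  let : MeasurableSpace (Ultrafilter Ω) := stoneSigma Ω
  let : MeasurableSpace S := ⊤
  choose ν hν using fun i : S => exists_stone_measure P hq (i : B)
  have hfinite : ∀ i, IsFiniteMeasure (ν i) := fun i =>
    ⟨by rw [← stoneSet_univ, hν i _ .univ]; exact ENNReal.ofReal_lt_top⟩
  have hst : ∀ A : Set Ω, MeasurableSet A → MeasurableSet (stoneSet A) := fun A hA =>
    MeasurableSpace.measurableSet_generateFrom ⟨A, hA, rfl⟩
  have hcell : ∀ (i : S) (A : Set Ω), MeasurableSet A →
      MeasurableSet (({i} : Set S) ×ˢ stoneSet A) := fun i A hA =>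
    (measurableSet_singleton i).prod (hst A hA)
  have hcellν : ∀ (i : S) (A : Set Ω), MeasurableSet A →
      sumMeasure ν (({i} : Set S) ×ˢ stoneSet A) = ENNReal.ofReal (‖P.proj A i‖ ^ p.toReal) :=
    fun i A hA => by rw [sumMeasure_singleton_prod ν i (hst A hA), hν i A hA]
  have hcellfin : ∀ (i : S) (A : Set Ω), MeasurableSet A →
      sumMeasure ν (({i} : Set S) ×ˢ stoneSet A) ≠ ∞ := fun i A hA => by
    rw [hcellν i A hA]; exact ENNReal.ofReal_ne_top
  -- Pulling back along `stoneSet` indexes the projections on the L^p side by the same sets as P, so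
  -- that norms can be compared term by term.
  let P' : ProjSystem p.toReal Ω (Lp ℂ p (sumMeasure ν)) :=
    (LpSystem (m := sumMeasure ν) hp0 hp).comap (fun A => Set.univ ×ˢ stoneSet A)
      (fun A hA => MeasurableSet.univ.prod (hst A hA)) (by rw [stoneSet_univ, Set.univ_prod_univ])
      (fun A D => by rw [stoneSet_inter, Set.prod_inter]) (fun A => by
        rw [stoneSet_compl]; ext x; simp)
  -- The model of the vector i is the indicator of the whole i-th copy of the Stone space.
  let e' : S → Lp ℂ p (sumMeasure ν) := fun i =>
    indicatorConstLp p (hcell i Set.univ .univ) (hcellfin i _ .univ) 1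
  have hproj : ∀ (i : S) (A : Set Ω) (hA : MeasurableSet A), P'.proj A (e' i) =
      indicatorConstLp p (hcell i A hA) (hcellfin i A hA) 1 := by
    intro i A hA
    refine (Lp.indicatorₗ_indicatorConstLp (MeasurableSet.univ.prod (hst A hA))
      (hcell i Set.univ .univ) (hcellfin i _ .univ) 1).trans ?_
    congr 1
    rw [stoneSet_univ, Set.prod_inter_prod]
    simp
  have hnorm : ∀ (i : S) (A : Set Ω), MeasurableSet A → ‖P.proj A (i : B)‖ = ‖P'.proj A (e' i)‖ := by
    intro i A hA
    rw [hproj i A hA, norm_indicatorConstLp hp0 hp, measureReal_def, hcellν i A hA,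
      ENNReal.toReal_ofReal (by positivity), ← Real.rpow_mul (norm_nonneg _),
      mul_one_div_cancel hq.ne']
    simp
  have hd : ∀ i j : S, i ≠ j → P.Disj (i : B) (j : B) := fun i j hij =>
    hS i.2 j.2 (Subtype.coe_injective.ne hij)
  have hd' : ∀ i j : S, i ≠ j → P'.Disj (e' i) (e' j) := by
    intro i j hij
    obtain ⟨A, hA, h1, h2⟩ := hd i j hij
    refine ⟨A, hA, ?_, ?_⟩
    · rw [tendsto_zero_iff_norm_tendsto_zero] at h1 ⊢
      simpa only [← hnorm i _ (hA _)] using h1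
    · rw [tendsto_zero_iff_norm_tendsto_zero] at h2 ⊢
      simpa only [← hnorm j _ (hA _).compl] using h2
  let T := Finsupp.linearCombination ℂ fun k : S × {A : Set Ω // MeasurableSet A} =>
    P.proj k.2 (k.1 : B)
  let T' := Finsupp.linearCombination ℂ fun k : S × {A : Set Ω // MeasurableSet A} =>
    P'.proj k.2 (e' k.1)
  have hTT' : ∀ v, ‖T v‖ = ‖T' v‖ := fun v => by
    simp only [T, T', Finsupp.linearCombination_apply, Finsupp.sum]
    exact ProjSystem.norm_sum_sum_smul_proj_eq hq hd hd' hnorm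
      (A := fun k : S × {A : Set Ω // MeasurableSet A} => (k.2 : Set Ω)) (fun k => k.2.2)
      (fun k => k.1) _ _
  have hT : DenseRange T := by
    intro b
    have hb : b ∈ P.band S := hband ▸ Submodule.mem_top
    refine closure_mono ?_ hb
    rw [← LinearMap.coe_range, Finsupp.range_linearCombination]
    refine Submodule.span_mono ?_
    rintro _ ⟨e, he, A, hA, rfl⟩
    exact ⟨(⟨e, he⟩, ⟨A, hA⟩), rfl⟩
  have hT' : DenseRange T' := by
    intro f
    rw [← LinearMap.coe_range, ← Submodule.topologicalClosure_coe]
    refine Lp_mem_of_measureDense hp (measureDense_sumMeasure fun i =>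
      Measure.MeasureDense.of_generateFrom_isSetAlgebra_finite (ν i) isSetAlgebra_stoneAlgebra rfl)
      (Submodule.isClosed_topologicalClosure _) ?_ f
    intro t ht hms c
    refine Submodule.le_topologicalClosure _ ?_
    have ht' := ht
    obtain ⟨F, A, hA, ht'⟩ := ht'
    have hA' : ∀ i, ∃ D : Set Ω, MeasurableSet D ∧ stoneSet D = A i := hA
    choose D hD hDA using hA'
    obtain rfl : (fun i => stoneSet (D i)) = A := funext hDA
    -- A finite union of disjoint cells is handled one cell at a time; the indicator of a cell is a
    -- projection of the corresponding e'.
    have key : ∀ (F : Finset S) (t : Set (S × Ultrafilter Ω)),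
        t = ⋃ i ∈ F, {i} ×ˢ stoneSet (D i) → ∀ (hm : MeasurableSet t) (hms : sumMeasure ν t ≠ ∞),
        indicatorConstLp p hm hms c ∈ LinearMap.range T' := by
      classical
      intro F
      induction F using Finset.induction_on with
      | empty =>
        rintro t ht hm hms
        simp only [Finset.notMem_empty, Set.iUnion_of_empty, Set.iUnion_empty] at ht
        subst ht
        rw [indicatorConstLp_empty]
        exact Submodule.zero_mem _
      | insert i F hi ih =>
        rintro t ht hm hms
        rw [Finset.set_biUnion_insert] at ht
        subst ht
        have hm' : MeasurableSet (⋃ i ∈ F, ({i} : Set S) ×ˢ stoneSet (D i)) :=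
          F.measurableSet_biUnion fun i _ => hcell i _ (hD i)
        have hms' : sumMeasure ν (⋃ i ∈ F, ({i} : Set S) ×ˢ stoneSet (D i)) ≠ ∞ :=
          measure_ne_top_of_subset Set.subset_union_right hms
        rw [indicatorConstLp_disjoint_union (hcell i _ (hD i)) hm' (hcellfin i _ (hD i)) hms']
        · refine Submodule.add_mem _ ?_ (ih _ rfl _ _)
          refine ⟨Finsupp.single (i, ⟨D i, hD i⟩) c, ?_⟩
          simp only [T', Finsupp.linearCombination_single]
          rw [hproj i _ (hD i), indicatorConstLp, indicatorConstLp, ← MemLp.toLp_const_smul]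
          congr 1
          ext x
          simp [Set.indicator]
        · rw [Set.disjoint_iff_inter_eq_empty]
          ext ⟨j, x⟩
          simp only [Set.mem_inter_iff, Set.mem_prod, Set.mem_singleton_iff, Set.mem_iUnion,
            Set.mem_empty_iff_false, iff_false]
          rintro ⟨⟨rfl, -⟩, k, hk, rfl, -⟩
          exact hi hk
    exact key F t ht' _ _
  obtain ⟨U, -⟩ := exists_linearIsometryEquiv_of_norm_eq T T' hT hT' hTT'
  exact ⟨S × Ultrafilter Ω, inferInstance, sumMeasure ν, ⟨U⟩⟩

/-! ### Banach space ultrapowers -/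

section Ultraproduct

variable {ι : Type*} (U : Ultrafilter ι) (E : Type*) [NormedAddCommGroup E] [NormedSpace ℂ E]

/-- The bounded families that converge to zero along the ultrafilter. -/
def nullFamilies : Submodule ℂ (lp (fun _ : ι => E) ∞) where
  carrier := {h | Tendsto (fun i => ‖h i‖) U (𝓝 0)}
  add_mem' {h k} hh hk := squeeze_zero (fun _ => norm_nonneg _) (fun i => norm_add_le (h i) (k i))
    (by simpa using Tendsto.add hh hk)
  zero_mem' := by simp
  smul_mem' c h hh := by
    have : Tendsto (fun i => ‖c‖ * ‖h i‖) U (𝓝 0) := by simpa using Tendsto.const_mul ‖c‖ hh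
    simpa [norm_smul] using this

/-- Closedness makes the quotient seminorm a norm; as an instance it is found by inference. -/
instance isClosed_nullFamilies : IsClosed (nullFamilies U E : Set (lp (fun _ : ι => E) ∞)) := by
  refine isClosed_of_closure_subset fun h hh => ?_
  refine tendsto_order.2 ⟨fun a ha => Eventually.of_forall fun i => ha.trans_le (norm_nonneg _),
    fun ε hε => ?_⟩
  obtain ⟨k, hk, hd⟩ := Metric.mem_closure_iff.1 hh (ε / 2) (by positivity)
  filter_upwards [(tendsto_order.1 hk).2 (ε / 2) (by positivity)] with i hi
  have h1 : ‖(h - k) i‖ < ε / 2 :=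
    (lp.norm_apply_le_norm ENNReal.top_ne_zero _ i).trans_lt (by rwa [← dist_eq_norm])
  calc ‖h i‖ = ‖(h - k) i + k i‖ := by simp
    _ < ε := (norm_add_le _ _).trans_lt (by linarith)

/-- The Banach space ultrapower of `E`. -/
abbrev Ultrapower : Type _ := lp (fun _ : ι => E) ∞ ⧸ nullFamilies U E

variable {U E}

namespace Ultrapower

/-- The class of a bounded family. -/
noncomputable def mk (U : Ultrafilter ι) : lp (fun _ : ι => E) ∞ →ₗ[ℂ] Ultrapower U E := (nullFamilies U E).mkQ

theorem mk_surjective : Function.Surjective (mk (E := E) U) := Submodule.mkQ_surjective _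

theorem mk_eq_mk_iff {h k : lp (fun _ : ι => E) ∞} :
    mk U h = mk U k ↔ Tendsto (fun i => ‖h i - k i‖) U (𝓝 0) :=
  Submodule.Quotient.eq _

/-- The limit c exists by compactness. Replacing the coordinates of norm above c + ε by 0 does not
change the class, which bounds the quotient norm by c; conversely every representative has the same
limit c, at most its supremum norm. -/
theorem tendsto_norm (h : lp (fun _ : ι => E) ∞) :
    Tendsto (fun i => ‖h i‖) U (𝓝 ‖mk U h‖) := by
  classical
  obtain ⟨c, -, hc⟩ : ∃ c ∈ Set.Icc 0 ‖h‖, Tendsto (fun i => ‖h i‖) U (𝓝 c) := by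
    obtain ⟨c, hc, hle⟩ := (isCompact_Icc (a := (0 : ℝ)) (b := ‖h‖)).ultrafilter_le_nhds
      (U.map fun i => ‖h i‖) (le_principal_iff.2 (mem_map.2 <| Eventually.of_forall fun i =>
        ⟨norm_nonneg _, lp.norm_apply_le_norm ENNReal.top_ne_zero h i⟩))
    exact ⟨c, hc, hle⟩
  have hc0 : 0 ≤ c := ge_of_tendsto' hc fun i => norm_nonneg _
  suffices ‖mk U h‖ = c by rwa [this]
  refine le_antisymm (le_of_forall_pos_le_add fun ε hε => ?_)
    (le_of_forall_pos_le_add fun ε hε => ?_)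
  · have hbd : ∀ i, ‖(if ‖h i‖ ≤ c + ε then h i else 0 : E)‖ ≤ c + ε := fun i => by
      split_ifs with hi
      · exact hi
      · rw [norm_zero]; positivity
    let k : lp (fun _ : ι => E) ∞ := ⟨fun i => if ‖h i‖ ≤ c + ε then h i else 0,
      memℓp_infty ⟨c + ε, by rintro _ ⟨i, rfl⟩; exact hbd i⟩⟩
    have hk : mk U h = mk U k := by
      rw [mk_eq_mk_iff]
      refine tendsto_const_nhds.congr' ?_
      filter_upwards [(tendsto_order.1 hc).2 (c + ε) (by linarith)] with i hi
      simp [k, hi.le]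
    rw [hk]
    have h1 : ‖mk U k‖ ≤ ‖k‖ := Submodule.Quotient.norm_mk_le (nullFamilies U E) k
    have h2 : ∀ i, ‖k i‖ ≤ c + ε := hbd
    exact h1.trans (lp.norm_le_of_forall_le (add_nonneg hc0 hε.le) h2)
  · obtain ⟨k, hk, hlt⟩ : ∃ k, mk U k = mk U h ∧ ‖k‖ < ‖mk U h‖ + ε :=
      Submodule.Quotient.norm_mk_lt (S := nullFamilies U E) (mk U h) hε
    have hk' : Tendsto (fun i => ‖h i - k i‖) U (𝓝 0) := mk_eq_mk_iff.1 hk.symm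
    have h1 : ∀ i, ‖h i‖ ≤ ‖h i - k i‖ + ‖k‖ := fun i => by
      have h2 := norm_add_le (h i - k i) (k i)
      rw [sub_add_cancel] at h2
      exact h2.trans (add_le_add le_rfl (lp.norm_apply_le_norm ENNReal.top_ne_zero k i))
    have h2 : c ≤ 0 + ‖k‖ := le_of_tendsto_of_tendsto' hc (hk'.add tendsto_const_nhds) h1
    linarith

/-- The operator on bounded families given by a family of contractions. -/
def familyMap (T : ι → E →ₗ[ℂ] E) (hT : ∀ i x, ‖T i x‖ ≤ ‖x‖) :
    lp (fun _ : ι => E) ∞ →ₗ[ℂ] lp (fun _ : ι => E) ∞ where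
  toFun h := ⟨fun i => T i (h i), memℓp_infty ⟨‖h‖, by
    rintro _ ⟨i, rfl⟩
    exact (hT i _).trans (lp.norm_apply_le_norm ENNReal.top_ne_zero h i)⟩⟩
  map_add' h k := by ext i; exact map_add (T i) _ _
  map_smul' c h := by ext i; exact map_smul (T i) _ _

/-- The operator on the ultrapower given by a family of contractions. -/
noncomputable def map (U : Ultrafilter ι) (T : ι → E →ₗ[ℂ] E) (hT : ∀ i x, ‖T i x‖ ≤ ‖x‖) :
    Ultrapower U E →ₗ[ℂ] Ultrapower U E :=
  (nullFamilies U E).mapQ _ (familyMap T hT) fun h hh =>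
    squeeze_zero (fun _ => norm_nonneg _) (fun i => hT i (h i)) hh

theorem map_mk (T : ι → E →ₗ[ℂ] E) (hT : ∀ i x, ‖T i x‖ ≤ ‖x‖) (h : lp (fun _ : ι => E) ∞) :
    map U T hT (mk U h) = mk U (familyMap T hT h) :=
  Submodule.mapQ_apply _ _ _ _

theorem map_comp (T S R : ι → E →ₗ[ℂ] E) (hT : ∀ i x, ‖T i x‖ ≤ ‖x‖) (hS : ∀ i x, ‖S i x‖ ≤ ‖x‖)
    (hR : ∀ i x, ‖R i x‖ ≤ ‖x‖) (h : ∀ i x, R i x = T i (S i x)) (b : Ultrapower U E) :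
    map U R hR b = map U T hT (map U S hS b) := by
  obtain ⟨k, rfl⟩ := mk_surjective b
  rw [map_mk, map_mk, map_mk]
  congr 1
  ext i
  exact h i (k i)

/-- The functional on the ultrapower given by a bounded family of functionals. -/
theorem exists_functional (ξ : ι → StrongDual ℂ E) (C : ℝ) (hξ : ∀ i, ‖ξ i‖ ≤ C) :
    ∃ Φ : StrongDual ℂ (Ultrapower U E), ∀ h : lp (fun _ : ι => E) ∞,
      Tendsto (fun i => ξ i (h i)) U (𝓝 (Φ (mk U h))) := by
  have hbd : ∀ i x, ‖ξ i x‖ ≤ C * ‖x‖ := fun i x =>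
    ((ξ i).le_opNorm x).trans (mul_le_mul_of_nonneg_right (hξ i) (norm_nonneg _))
  have hex : ∀ h : lp (fun _ : ι => E) ∞, ∃ z : ℂ, Tendsto (fun i => ξ i (h i)) U (𝓝 z) := by
    intro h
    obtain ⟨c, -, hle⟩ := (isCompact_closedBall (0 : ℂ) (|C| * ‖h‖)).ultrafilter_le_nhds
      (U.map fun i => ξ i (h i)) (le_principal_iff.2 (mem_map.2 <| Eventually.of_forall fun i => by
        simp only [Metric.mem_closedBall, dist_zero_right]
        exact (hbd i _).trans (mul_le_mul (le_abs_self C)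
          (lp.norm_apply_le_norm ENNReal.top_ne_zero h i) (norm_nonneg _) (abs_nonneg _))))
    exact ⟨c, hle⟩
  choose φ hφ using hex
  let φl : lp (fun _ : ι => E) ∞ →ₗ[ℂ] ℂ :=
    { toFun := φ
      map_add' := fun h k => tendsto_nhds_unique (hφ (h + k))
        (((hφ h).add (hφ k)).congr fun i => (map_add (ξ i) _ _).symm)
      map_smul' := fun c h => tendsto_nhds_unique (hφ (c • h))
        (((hφ h).const_smul c).congr fun i => (map_smul (ξ i) _ _).symm) }
  -- Being bounded by the ultrapower norm, φ vanishes on null families and descends to the quotient.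
  have hφn : ∀ h, ‖φ h‖ ≤ C * ‖mk U h‖ := fun h =>
    le_of_tendsto_of_tendsto' (hφ h).norm ((tendsto_norm h).const_mul C) fun i => hbd i _
  let ψ : Ultrapower U E →ₗ[ℂ] ℂ := (nullFamilies U E).liftQ φl fun h hh => by
    have h0 : mk U h = 0 := (Submodule.Quotient.mk_eq_zero _).2 hh
    have := hφn h
    rw [h0, norm_zero, mul_zero] at this
    exact norm_le_zero_iff.1 this
  have hψ : ∀ h, ψ (mk U h) = φ h := fun h => Submodule.liftQ_apply _ _ _
  refine ⟨ψ.mkContinuous C fun b => ?_, fun h => ?_⟩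
  · obtain ⟨h, rfl⟩ := mk_surjective b
    rw [hψ]; exact hφn h
  · rw [LinearMap.mkContinuous_apply, hψ]; exact hφ h

end Ultrapower

/-- The slice of a subset of `ι × Y` at `i`. -/
def slice {ι Y : Type*} (i : ι) (A : Set (Σ _ : ι, Y)) : Set Y := {y | ⟨i, y⟩ ∈ A}

theorem measurableSet_sigma_iff {α : Type*} {β : α → Type*} [∀ a, MeasurableSpace (β a)]
    {s : Set (Σ a, β a)} : MeasurableSet s ↔ ∀ a, MeasurableSet (Sigma.mk a ⁻¹' s) :=
  MeasurableSpace.measurableSet_iInf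

theorem measurable_sigma_iff {α γ : Type*} {β : α → Type*} [∀ a, MeasurableSpace (β a)]
    [MeasurableSpace γ] {f : (Σ a, β a) → γ} :
    Measurable f ↔ ∀ a, Measurable fun b => f ⟨a, b⟩ :=
  ⟨fun hf a _ ht => measurableSet_sigma_iff.1 (hf ht) a,
    fun hf _ ht => measurableSet_sigma_iff.2 fun a => hf a ht⟩

theorem MeasurableSet.slice {ι Y : Type*} [MeasurableSpace Y] {A : Set (Σ _ : ι, Y)}
    (hA : MeasurableSet A) (i : ι) : MeasurableSet (slice i A) :=
  measurableSet_sigma_iff.1 hA i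

open Classical in
/-- The slicewise action of a system of projections on the ultrapower. -/
noncomputable def ProjSystem.ultrapower {Y : Type*} [MeasurableSpace Y] {q : ℝ} (hq : 0 < q)
    (P : ProjSystem q Y E) (U : Ultrafilter ι) :
    ProjSystem q (Σ _ : ι, Y) (Ultrapower U E) where
  proj A := if hA : MeasurableSet A then
    Ultrapower.map U (fun i => P.proj (slice i A))
      fun i => P.norm_proj_le hq (hA.slice i) else 0
  proj_univ b := by
    obtain ⟨h, rfl⟩ := Ultrapower.mk_surjective b
    rw [dif_pos MeasurableSet.univ, Ultrapower.map_mk]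
    congr 1
    ext i
    exact P.proj_univ _
  proj_inter {A D} hA hD b := by
    rw [dif_pos hA, dif_pos hD, dif_pos (hA.inter hD)]
    exact Ultrapower.map_comp _ _ _ _ _ _ (fun i x => P.proj_inter
      (hA.slice i) (hD.slice i) x) b
  proj_union {A D} hA hD hd b := by
    obtain ⟨h, rfl⟩ := Ultrapower.mk_surjective b
    rw [dif_pos hA, dif_pos hD, dif_pos (hA.union hD), Ultrapower.map_mk, Ultrapower.map_mk,
      Ultrapower.map_mk, ← map_add]
    congr 1
    ext i
    exact P.proj_union (hA.slice i) (hD.slice i)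
      (hd.preimage _) _
  norm_rpow {A} hA b := by
    obtain ⟨h, rfl⟩ := Ultrapower.mk_surjective b
    rw [dif_pos hA, dif_pos hA.compl, Ultrapower.map_mk, Ultrapower.map_mk]
    refine tendsto_nhds_unique ((Ultrapower.tendsto_norm h).rpow_const (.inr hq.le))
      ((((Ultrapower.tendsto_norm _).rpow_const (.inr hq.le)).add
        ((Ultrapower.tendsto_norm _).rpow_const (.inr hq.le))).congr fun i => ?_)
    exact (P.norm_rpow (hA.slice i) (h i)).symm

theorem ProjSystem.ultrapower_proj_mk {Y : Type*} [MeasurableSpace Y] {q : ℝ} (hq : 0 < q)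
    (P : ProjSystem q Y E) (U : Ultrafilter ι) {A : Set (Σ _ : ι, Y)} (hA : MeasurableSet A)
    (h : lp (fun _ : ι => E) ∞) :
    (P.ultrapower hq U).proj A (Ultrapower.mk U h) =
      Ultrapower.mk U (Ultrapower.familyMap (fun i => P.proj (slice i A))
        (fun i => P.norm_proj_le hq (hA.slice i)) h) := by
  rw [← Ultrapower.map_mk]
  simp only [ProjSystem.ultrapower, dif_pos hA]

end Ultraproduct

/-! ### Ultrapowers of L^p are multiplicity free -/

section UltraLp

variable {ι Y : Type*} {U : Ultrafilter ι} [MeasurableSpace Y] {m : Measure Y} {p : ℝ≥0∞}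
  [Fact (1 ≤ p)]

/-- A finite δ-net of a disc with measurable nearest-point selection. One N and one list d then
serve all coordinates of an ultrapower at once. -/
theorem exists_simple_approx (n δ : ℝ) (hδ : 0 < δ) : ∃ (N : ℕ) (d : ℕ → ℂ) (k : ℂ → ℕ),
    Measurable k ∧ ∀ z, ‖z‖ ≤ n → k z < N ∧ ‖z - d (k z)‖ ≤ δ := by
  obtain ⟨t, -, htf, ht⟩ := (isCompact_closedBall (0 : ℂ) n).finite_cover_balls hδ
  obtain ⟨N, d, hN⟩ : ∃ (N : ℕ) (d : ℕ → ℂ), ∀ z ∈ t, ∃ k ≤ N, d k = z := by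
    lift t to Finset ℂ using htf
    exact ⟨t.card, fun k => if h : k < t.card then t.equivFin.symm ⟨k, h⟩ else 0, fun z hz =>
      ⟨t.equivFin ⟨z, hz⟩, (t.equivFin ⟨z, hz⟩).2.le, by simp⟩⟩
  refine ⟨N + 1, d, SimpleFunc.nearestPtInd d N, (SimpleFunc.nearestPtInd d N).measurable,
    fun z hz => ⟨Nat.lt_succ_of_le (SimpleFunc.nearestPtInd_le _ _ _), ?_⟩⟩
  obtain ⟨c, hct, hzc⟩ := Set.mem_iUnion₂.1 (ht (show z ∈ Metric.closedBall 0 n by simpa using hz))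
  obtain ⟨k, hk, rfl⟩ := hN c hct
  have h1 := SimpleFunc.edist_nearestPt_le d z hk
  rw [edist_dist, edist_dist, ENNReal.ofReal_le_ofReal_iff dist_nonneg, SimpleFunc.nearestPt,
    SimpleFunc.map_apply] at h1
  rw [← dist_eq_norm, dist_comm]
  rw [Metric.mem_ball, dist_comm] at hzc
  exact h1.trans hzc.le

/-- On {|h| ≤ n|g|} the quotient h/g is bounded by n, uniformly in the coordinate, hence uniformly
approximable by simple functions; on the complement |g| < |h|/n. -/
theorem multiplicityFree_ultrapower_LpSystem (hp0 : p ≠ 0) (hp : p ≠ ∞) :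
    ((LpSystem (m := m) hp0 hp).ultrapower (ENNReal.toReal_pos hp0 hp) U).MultiplicityFree := by
  intro b e ε hε
  obtain ⟨h, rfl⟩ := Ultrapower.mk_surjective b
  obtain ⟨g, rfl⟩ := Ultrapower.mk_surjective e
  have hq := ENNReal.toReal_pos hp0 hp
  set P := LpSystem (m := m) hp0 hp
  obtain ⟨n, hn0, hn⟩ : ∃ n : ℝ, 0 < n ∧ ‖Ultrapower.mk U h‖ / n ≤ ε :=
    ⟨(‖Ultrapower.mk U h‖ + 1) / ε, by positivity, by
      rw [div_le_iff₀ (by positivity), mul_div_cancel₀ _ hε.ne']; linarith⟩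
  have hmh : ∀ i, Measurable (h i : Y → ℂ) := fun i => (Lp.stronglyMeasurable (h i)).measurable
  have hmg : ∀ i, Measurable (g i : Y → ℂ) := fun i => (Lp.stronglyMeasurable (g i)).measurable
  set A : Set (Σ _ : ι, Y) := {ω | ‖h ω.1 ω.2‖ ≤ n * ‖g ω.1 ω.2‖} with hAdef
  have hA : MeasurableSet A := measurableSet_sigma_iff.2 fun i =>
    measurableSet_le (hmh i).norm ((hmg i).norm.const_mul n)
  refine ⟨A, hA, ?_, ?_⟩
  · refine Metric.mem_closure_iff.2 fun ε' hε' => ?_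
    -- Gives δ‖g‖ < ε' even when ‖g‖ = 0.
    set δ := ε' / (2 * (‖Ultrapower.mk U g‖ + 1)) with hδdef
    have hδ : 0 < δ := by positivity
    obtain ⟨N, d, k, hk, hkd⟩ := exists_simple_approx n δ hδ
    -- Where g = 0 the quotient takes the value 0, which is harmless: on A, h vanishes there too.
    let φ : (Σ _ : ι, Y) → ℂ := fun ω => h ω.1 ω.2 / g ω.1 ω.2
    have hφ : Measurable φ := measurable_sigma_iff.2 fun i => (hmh i).div (hmg i)
    let D : ℕ → Set (Σ _ : ι, Y) := fun j => A ∩ (fun ω => k (φ ω)) ⁻¹' {j}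
    have hD : ∀ j, MeasurableSet (D j) := fun j =>
      hA.inter ((hk.comp hφ) (measurableSet_singleton j))
    let Dg : ℕ → lp (fun _ : ι => Lp ℂ p m) ∞ := fun j =>
      Ultrapower.familyMap (fun i => P.proj (slice i (D j)))
        (fun i => P.norm_proj_le hq ((hD j).slice i)) g
    refine ⟨∑ j ∈ Finset.range N, d j • (P.ultrapower hq U).proj (D j) (Ultrapower.mk U g),
      Submodule.sum_mem _ fun j _ => Submodule.smul_mem _ _
        (Submodule.subset_span ⟨D j, hD j, rfl⟩), ?_⟩
    have hsum : ∑ j ∈ Finset.range N, d j • (P.ultrapower hq U).proj (D j) (Ultrapower.mk U g) =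
        Ultrapower.mk U (∑ j ∈ Finset.range N, d j • Dg j) := by
      rw [map_sum]
      exact Finset.sum_congr rfl fun j _ => by rw [map_smul, P.ultrapower_proj_mk hq U (hD j)]
    rw [dist_eq_norm, P.ultrapower_proj_mk hq U hA, hsum, ← map_sub]
    have key : ‖Ultrapower.mk U (Ultrapower.familyMap (fun i => P.proj (slice i A))
        (fun i => P.norm_proj_le hq (hA.slice i)) h -
        ∑ j ∈ Finset.range N, d j • Dg j)‖ ≤ δ * ‖Ultrapower.mk U g‖ := by
      refine le_of_tendsto_of_tendsto' (Ultrapower.tendsto_norm _)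
        ((Ultrapower.tendsto_norm g).const_mul δ) fun i => ?_
      have hval : (Ultrapower.familyMap (fun i => P.proj (slice i A))
          (fun i => P.norm_proj_le hq (hA.slice i)) h -
          ∑ j ∈ Finset.range N, d j • Dg j) i = Lp.indicatorₗ p m (slice i A) (h i) -
          ∑ j ∈ Finset.range N, d j • Lp.indicatorₗ p m (slice i (D j)) (g i) := by
        rw [lp.coeFn_sub, Pi.sub_apply, lp.coeFn_sum, Finset.sum_apply]
        rfl
      rw [hval]
      refine Lp.norm_le_mul_norm_of_ae_le_mul ?_
      have hDae : ∀ᵐ y ∂m, ∀ j, (Lp.indicatorₗ p m (slice i (D j)) (g i)) y =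
          (slice i (D j)).indicator (g i) y := ae_all_iff.2 fun j =>
        Lp.coeFn_indicatorₗ ((hD j).slice i) (g i)
      have hsmul : ∀ᵐ y ∂m, ∀ j, (d j • Lp.indicatorₗ p m (slice i (D j)) (g i) : Lp ℂ p m) y =
          d j • (Lp.indicatorₗ p m (slice i (D j)) (g i)) y := ae_all_iff.2 fun j =>
        Lp.coeFn_smul _ _
      filter_upwards [Lp.coeFn_sub (Lp.indicatorₗ p m (slice i A) (h i))
        (∑ j ∈ Finset.range N, d j • Lp.indicatorₗ p m (slice i (D j)) (g i)),
        Lp.coeFn_finsetSum (Finset.range N)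
          (fun j => d j • Lp.indicatorₗ p m (slice i (D j)) (g i)),
        Lp.coeFn_indicatorₗ (hA.slice i) (h i), hDae, hsmul]
        with y h1 h2 h3 h4 h5
      rw [h1, Pi.sub_apply, h2, h3, Finset.sum_apply]
      simp_rw [h5, h4]
      by_cases hy : (⟨i, y⟩ : Σ _ : ι, Y) ∈ A
      · have hle : ‖h i y‖ ≤ n * ‖g i y‖ := hy
        have hind : ∀ j, (slice i (D j)).indicator (g i) y =
            if j = k (φ ⟨i, y⟩) then g i y else 0 := fun j => by
          split_ifs with hj
          · exact Set.indicator_of_mem (show y ∈ slice i (D j) from ⟨hy, hj.symm⟩) _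
          · exact Set.indicator_of_notMem (fun h => hj (Eq.symm h.2)) _
        simp_rw [hind, smul_ite, smul_zero]
        rw [Set.indicator_of_mem (show y ∈ slice i A from hy)]
        by_cases hg0 : g i y = 0
        · have hh0 : h i y = 0 := by simpa [hg0] using hle
          simp [hg0, hh0]
        · have hφn : ‖φ ⟨i, y⟩‖ ≤ n := by
            rw [norm_div, div_le_iff₀ (norm_pos_iff.2 hg0)]; exact hle
          obtain ⟨hkN, hkδ⟩ := hkd _ hφn
          rw [Finset.sum_ite_eq' , if_pos (Finset.mem_range.2 hkN)]
          have : h i y = φ ⟨i, y⟩ * g i y := (div_mul_cancel₀ _ hg0).symm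
          rw [this, smul_eq_mul, ← sub_mul, norm_mul]
          exact mul_le_mul_of_nonneg_right hkδ (norm_nonneg _)
      · have hind : ∀ j, (slice i (D j)).indicator (g i) y = 0 := fun j =>
          Set.indicator_of_notMem (fun hD => hy hD.1) _
        simp_rw [hind]
        rw [Set.indicator_of_notMem (show y ∉ slice i A from hy)]
        simp only [smul_zero, Finset.sum_const_zero, sub_zero, norm_zero]
        positivity
    refine key.trans_lt ?_
    rw [hδdef, div_mul_eq_mul_div, div_lt_iff₀ (by positivity)]
    nlinarith [norm_nonneg (Ultrapower.mk U g)]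
  · rw [P.ultrapower_proj_mk hq U hA.compl]
    refine le_trans ?_ hn
    refine le_of_tendsto_of_tendsto' (Ultrapower.tendsto_norm _)
      ((Ultrapower.tendsto_norm h).div_const n) fun i => ?_
    change ‖Lp.indicatorₗ p m (slice i (Aᶜ)) (g i)‖ ≤ _
    rw [div_eq_inv_mul]
    refine Lp.norm_le_mul_norm_of_ae_le_mul ?_
    filter_upwards [Lp.coeFn_indicatorₗ (hA.compl.slice i) (g i)] with y hy
    rw [hy, ← div_eq_inv_mul, le_div_iff₀ hn0]
    by_cases hyA : (⟨i, y⟩ : Σ _ : ι, Y) ∈ A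
    · rw [Set.indicator_of_notMem (show y ∉ slice i (Aᶜ) from fun h => h hyA), norm_zero,
        zero_mul]
      exact norm_nonneg _
    · rw [Set.indicator_of_mem (show y ∈ slice i (Aᶜ) from hyA), mul_comm]
      exact (not_le.1 hyA).le

end UltraLp

/-! ### Norming vectors and norm-attaining functionals on L^q -/

/-- The norming vector `‖z‖^(q-2) z̄` of `z`. -/
noncomputable def dualVec (q : ℝ) (z : ℂ) : ℂ := ((‖z‖ ^ (q - 2) : ℝ) : ℂ) * (starRingEnd ℂ) z

theorem norm_dualVec {q : ℝ} (hq : 1 < q) (z : ℂ) : ‖dualVec q z‖ = ‖z‖ ^ (q - 1) := by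
  rw [dualVec, norm_mul, Complex.norm_real, RCLike.norm_conj, Real.norm_of_nonneg (by positivity)]
  rcases eq_or_ne z 0 with rfl | hz
  · simp [Real.zero_rpow (sub_pos.2 hq).ne']
  · rw [← Real.rpow_add_one (norm_ne_zero_iff.2 hz)]
    congr 1; ring

theorem mul_dualVec {q : ℝ} (hq : 1 < q) (z : ℂ) : z * dualVec q z = ((‖z‖ ^ q : ℝ) : ℂ) := by
  rcases eq_or_ne z 0 with rfl | hz
  · simp [Real.zero_rpow (zero_lt_one.trans hq).ne']
  · rw [dualVec, mul_left_comm, Complex.mul_conj, Complex.normSq_eq_norm_sq, ← Complex.ofReal_mul,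
      ← Real.rpow_natCast, ← Real.rpow_add (norm_pos_iff.2 hz)]
    congr 2; push_cast; ring

theorem measurable_dualVec (q : ℝ) : Measurable (dualVec q) := by
  unfold dualVec
  have h1 : Measurable fun z : ℂ => ‖z‖ ^ (q - 2) := measurable_norm.pow_const _
  exact (Complex.measurable_ofReal.comp h1).mul Complex.continuous_conj.measurable

section

variable {Z : Type*} [MeasurableSpace Z] {m : Measure Z}

theorem Lp_integral_norm_rpow {p : ℝ≥0∞} (hp0 : p ≠ 0) (hp : p ≠ ∞) (f : Lp ℂ p m) :
    ∫ x, ‖f x‖ ^ p.toReal ∂m = ‖f‖ ^ p.toReal := by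
  have hm := (Lp.stronglyMeasurable f).measurable
  rw [Lp_norm_rpow_eq hp0 hp, integral_eq_lintegral_of_nonneg_ae
    (ae_of_all _ fun x => by positivity) (hm.norm.pow_const _).aestronglyMeasurable]
  congr 1
  refine lintegral_congr fun x => ?_
  rw [← ENNReal.ofReal_rpow_of_nonneg (norm_nonneg _) ENNReal.toReal_nonneg, ofReal_norm]

variable {p q : ℝ≥0∞}

theorem ne_zero_of_toReal_holderConjugate (h : q.toReal.HolderConjugate p.toReal) : q ≠ 0 :=
  fun h0 => by have := h.pos; simp [h0] at this

theorem ne_top_of_toReal_holderConjugate (h : q.toReal.HolderConjugate p.toReal) : q ≠ ∞ :=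
  fun h0 => by have := h.pos; simp [h0] at this

theorem norm_dualVec_rpow (h : q.toReal.HolderConjugate p.toReal) (z : ℂ) :
    ‖dualVec q.toReal z‖ ^ p.toReal = ‖z‖ ^ q.toReal := by
  rw [norm_dualVec h.lt, ← Real.rpow_mul (norm_nonneg _), h.sub_one_mul_conj]

theorem memLp_dualVec (h : q.toReal.HolderConjugate p.toReal) (f : Lp ℂ q m) :
    MemLp (fun x => dualVec q.toReal (f x)) p m := by
  have hm := (Lp.stronglyMeasurable f).measurable
  refine (integrable_norm_rpow_iff ((measurable_dualVec _).comp hm).aestronglyMeasurable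
    (ne_zero_of_toReal_holderConjugate h.symm) (ne_top_of_toReal_holderConjugate h.symm)).1 ?_
  refine (integrable_congr (ae_of_all _ fun x => norm_dualVec_rpow h (f x))).2 ?_
  exact (Lp.memLp f).integrable_norm_rpow (ne_zero_of_toReal_holderConjugate h)
    (ne_top_of_toReal_holderConjugate h)

/-- The norming element `|f|^(q-2) f̄ ∈ L^p` of `f ∈ L^q`. -/
noncomputable def dualLp (h : q.toReal.HolderConjugate p.toReal) (f : Lp ℂ q m) : Lp ℂ p m :=
  (memLp_dualVec h f).toLp _

theorem coeFn_dualLp (h : q.toReal.HolderConjugate p.toReal) (f : Lp ℂ q m) :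
    dualLp h f =ᵐ[m] fun x => dualVec q.toReal (f x) :=
  (memLp_dualVec h f).coeFn_toLp

theorem norm_dualLp_rpow (h : q.toReal.HolderConjugate p.toReal) (f : Lp ℂ q m) :
    ‖dualLp h f‖ ^ p.toReal = ‖f‖ ^ q.toReal := by
  rw [← Lp_integral_norm_rpow (ne_zero_of_toReal_holderConjugate h.symm)
    (ne_top_of_toReal_holderConjugate h.symm), ← Lp_integral_norm_rpow
    (ne_zero_of_toReal_holderConjugate h) (ne_top_of_toReal_holderConjugate h)]
  refine integral_congr_ae ?_
  filter_upwards [coeFn_dualLp h f] with x hx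
  rw [hx, norm_dualVec_rpow h]

theorem integral_mul_dualLp (h : q.toReal.HolderConjugate p.toReal) (f : Lp ℂ q m) :
    ∫ x, f x * dualLp h f x ∂m = ((‖f‖ ^ q.toReal : ℝ) : ℂ) := by
  rw [← Lp_integral_norm_rpow (ne_zero_of_toReal_holderConjugate h)
    (ne_top_of_toReal_holderConjugate h), ← integral_complex_ofReal]
  refine integral_congr_ae ?_
  filter_upwards [coeFn_dualLp h f] with x hx
  rw [hx, mul_dualVec h.lt]

theorem hasDerivAt_norm_add_mul_rpow {q : ℝ} (hq : 1 < q) (a b : ℂ) (t : ℝ) :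
    HasDerivAt (fun t : ℝ => ‖a + (t : ℂ) * b‖ ^ q) (q * (b * dualVec q (a + t * b)).re) t := by
  have h1 : HasDerivAt (fun t : ℝ => a + (t : ℂ) * b) b t := by
    simpa using ((Complex.ofRealCLM.hasDerivAt (x := t)).mul_const b).const_add a
  have h2 := (hasFDerivAt_norm_rpow (a + (t : ℂ) * b) hq).comp_hasDerivAt t h1
  refine h2.congr_deriv ?_
  simp only [_root_.smul_apply, innerSL_apply_apply, Complex.inner, smul_eq_mul,
    dualVec]
  rw [mul_left_comm b, Complex.re_ofReal_mul, mul_comm b, mul_assoc]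

/-- Differentiation under the integral sign; for |t| < 1 the derivative of the integrand is
dominated by q(|f| + |g|)^q. -/
theorem hasDerivAt_norm_add_smul_rpow (h : q.toReal.HolderConjugate p.toReal) (g f : Lp ℂ q m) :
    HasDerivAt (fun t : ℝ => ‖g + (t : ℂ) • f‖ ^ q.toReal)
      (q.toReal * (∫ x, f x * dualLp h g x ∂m).re) 0 := by
  have hq0 := ne_zero_of_toReal_holderConjugate h
  have hq := ne_top_of_toReal_holderConjugate h
  have hmf := (Lp.stronglyMeasurable f).measurable
  have hmg := (Lp.stronglyMeasurable g).measurable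
  have h1 : (fun t : ℝ => ‖g + (t : ℂ) • f‖ ^ q.toReal) =
      fun t : ℝ => ∫ x, ‖g x + (t : ℂ) * f x‖ ^ q.toReal ∂m := by
    ext t
    rw [← Lp_integral_norm_rpow hq0 hq]
    refine integral_congr_ae ?_
    filter_upwards [Lp.coeFn_add g ((t : ℂ) • f), Lp.coeFn_smul (t : ℂ) f] with x h1 h2
    rw [h1, Pi.add_apply, h2, Pi.smul_apply, smul_eq_mul]
  have hint : Integrable (fun x => q.toReal * (‖f x‖ + ‖g x‖) ^ q.toReal) m := by
    have := ((Lp.memLp f).norm.add (Lp.memLp g).norm).integrable_norm_rpow hq0 hq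
    refine (this.const_mul q.toReal).congr (ae_of_all _ fun x => ?_)
    simp only [Pi.add_apply]
    rw [Real.norm_of_nonneg (by positivity)]
  have key := hasDerivAt_integral_of_dominated_loc_of_deriv_le (μ := m) (x₀ := (0 : ℝ))
    (F := fun (t : ℝ) x => ‖g x + (t : ℂ) * f x‖ ^ q.toReal)
    (F' := fun t x => q.toReal * (f x * dualVec q.toReal (g x + t * f x)).re)
    (bound := fun x => q.toReal * (‖f x‖ + ‖g x‖) ^ q.toReal)
    (Metric.ball_mem_nhds (0 : ℝ) one_pos)
    (Eventually.of_forall fun t =>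
      ((hmg.add (hmf.const_mul _)).norm.pow_const _).aestronglyMeasurable)
    (by simpa using (Lp.memLp g).integrable_norm_rpow hq0 hq)
    ((Complex.measurable_re.comp (hmf.mul ((measurable_dualVec _).comp
      (hmg.add (hmf.const_mul _))))).const_mul _).aestronglyMeasurable
    (ae_of_all _ fun x t ht => by
      have ht' : |t| ≤ 1 := by simpa using (Metric.mem_ball.1 ht).le
      rw [norm_mul, Real.norm_of_nonneg h.nonneg]
      refine mul_le_mul_of_nonneg_left ((Complex.abs_re_le_norm _).trans ?_) h.nonneg
      rw [norm_mul, norm_dualVec h.lt]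
      have hle : ‖g x + (t : ℂ) * f x‖ ≤ ‖f x‖ + ‖g x‖ := by
        refine (norm_add_le _ _).trans ?_
        rw [norm_mul, Complex.norm_real, Real.norm_eq_abs, add_comm]
        exact add_le_add (mul_le_of_le_one_left (norm_nonneg _) ht') le_rfl
      calc ‖f x‖ * ‖g x + (t : ℂ) * f x‖ ^ (q.toReal - 1)
          ≤ (‖f x‖ + ‖g x‖) * (‖f x‖ + ‖g x‖) ^ (q.toReal - 1) :=
            mul_le_mul (le_add_of_nonneg_right (norm_nonneg _))
              (Real.rpow_le_rpow (norm_nonneg _) hle h.sub_one_pos.le) (by positivity)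
              (by positivity)
        _ = (‖f x‖ + ‖g x‖) ^ q.toReal := by
            rw [← Real.rpow_one_add' (by positivity) (by linarith [h.pos])]
            congr 1; ring)
    hint
    (ae_of_all _ fun x t _ => hasDerivAt_norm_add_mul_rpow h.lt (g x) (f x) t)
  rw [h1]
  refine key.2.congr_deriv ?_
  rw [integral_const_mul]
  congr 1
  have hfi : Integrable (fun x => f x * dualLp h g x) m := by
    have : ENNReal.HolderTriple q p 1 := ENNReal.HolderConjugate.of_toReal h
    exact (Lp.memLp f).integrable_mul (Lp.memLp _)
  rw [← RCLike.re_eq_complex_re, ← integral_re hfi]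
  refine integral_congr_ae ?_
  filter_upwards [coeFn_dualLp h g] with x hx
  simp [hx]

/-- A functional on `L^q` that attains its norm is given by the pairing with an element of
`L^p`. -/
theorem exists_integral_repr_of_norm_attained (h : q.toReal.HolderConjugate p.toReal)
    [Fact (1 ≤ q)] [Fact (1 ≤ p)] (Φ : StrongDual ℂ (Lp ℂ q m)) {M : ℝ} (hΦ : ∀ f, ‖Φ f‖ ≤ M * ‖f‖)
    {g : Lp ℂ q m} (hg0 : g ≠ 0) (hg : Φ g = ((M * ‖g‖ : ℝ) : ℂ)) :
    ∃ ξ : Lp ℂ p m, ‖ξ‖ ≤ M ∧ ∀ f, Φ f = ∫ x, f x * ξ x ∂m := by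
  have hgpos : 0 < ‖g‖ := norm_pos_iff.2 hg0
  have hM : 0 ≤ M := nonneg_of_mul_nonneg_left ((norm_nonneg _).trans (hΦ g)) hgpos
  set c : ℝ := M * ‖g‖ ^ (1 - q.toReal) with hc
  have hc0 : 0 ≤ c := by positivity
  have hnorm : ‖dualLp h g‖ = ‖g‖ ^ (q.toReal - 1) := by
    rw [← Real.rpow_left_inj (norm_nonneg _) (by positivity) h.symm.ne_zero, norm_dualLp_rpow h,
      ← Real.rpow_mul (norm_nonneg _), h.sub_one_mul_conj]
  have hre : ∀ f, (Φ f).re = c * (∫ x, f x * dualLp h g x ∂m).re := by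
    intro f
    have h1 := (hasDerivAt_norm_add_smul_rpow h g f).rpow_const (p := q.toReal⁻¹)
      (.inl (by simpa using (Real.rpow_pos_of_pos hgpos _).ne'))
    -- This function is M‖g + tf‖ − Re Φ(g + tf): nonnegative, and zero at t = 0. Its derivative at
    -- 0 therefore vanishes, which computes Re Φ(f).
    have h2 : HasDerivAt (fun t : ℝ => M * ‖g + (t : ℂ) • f‖ - (M * ‖g‖ + t * (Φ f).re))
        (c * (∫ x, f x * dualLp h g x ∂m).re - (Φ f).re) 0 := by
      have h3 : (fun t : ℝ => (‖g + (t : ℂ) • f‖ ^ q.toReal) ^ q.toReal⁻¹) =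
          fun t : ℝ => ‖g + (t : ℂ) • f‖ := by
        ext t; rw [Real.rpow_rpow_inv (norm_nonneg _) h.ne_zero]
      rw [h3] at h1
      have h4 := (h1.const_mul M).sub
        (((hasDerivAt_id (0 : ℝ)).mul_const (Φ f).re).const_add (M * ‖g‖))
      refine h4.congr_deriv ?_
      simp only [Complex.ofReal_zero, zero_smul, add_zero, one_mul]
      rw [← Real.rpow_mul (norm_nonneg _), mul_sub, mul_inv_cancel₀ h.ne_zero, mul_one, hc]
      field_simp [h.ne_zero]
    have h5 : IsLocalMin (fun t : ℝ => M * ‖g + (t : ℂ) • f‖ - (M * ‖g‖ + t * (Φ f).re)) 0 := by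
      refine Eventually.of_forall fun t => ?_
      have h6 : (Φ (g + (t : ℂ) • f)).re = M * ‖g‖ + t * (Φ f).re := by
        rw [map_add, map_smul, hg, Complex.add_re, Complex.ofReal_re, smul_eq_mul,
          Complex.re_ofReal_mul]
      have h7 := (Complex.re_le_norm _).trans (hΦ (g + (t : ℂ) • f))
      rw [h6] at h7
      simpa using h7
    have := h5.hasDerivAt_eq_zero h2
    linarith
  refine ⟨(c : ℂ) • dualLp h g, ?_, fun f => ?_⟩
  · rw [norm_smul, Complex.norm_real, Real.norm_of_nonneg hc0, hnorm, hc, mul_assoc,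
      ← Real.rpow_add hgpos]
    simp
  · have h1 : ∀ f, Φ f = c * ∫ x, f x * dualLp h g x ∂m := by
      intro f
      refine Complex.ext (by rw [hre f, Complex.re_ofReal_mul]) ?_
      -- The real part at −i f is the imaginary part at f.
      have h2 := hre ((-Complex.I) • f)
      have h3 : ∫ x, ((-Complex.I) • f : Lp ℂ q m) x * dualLp h g x ∂m =
          -Complex.I * ∫ x, f x * dualLp h g x ∂m := by
        rw [← integral_const_mul]
        refine integral_congr_ae ?_
        filter_upwards [Lp.coeFn_smul (-Complex.I) f] with x hx
        rw [hx, Pi.smul_apply, smul_eq_mul, mul_assoc]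
      rw [h3, map_smul, smul_eq_mul] at h2
      rw [Complex.im_ofReal_mul]
      simpa using h2
    rw [h1 f, ← integral_const_mul]
    refine integral_congr_ae ?_
    filter_upwards [Lp.coeFn_smul (c : ℂ) (dualLp h g)] with x hx
    rw [hx, Pi.smul_apply, smul_eq_mul, mul_left_comm]

end

/-! ### The pairing of L^q and L^p, and limits of coefficients -/

section Pairing

variable {Z : Type*} [MeasurableSpace Z] {m : Measure Z} {p q : ℝ≥0∞}

theorem integrable_mul_Lp (h : q.toReal.HolderConjugate p.toReal) (f : Lp ℂ q m) (g : Lp ℂ p m) :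
    Integrable (fun x => f x * g x) m := by
  have : ENNReal.HolderTriple q p 1 := ENNReal.HolderConjugate.of_toReal h
  exact (Lp.memLp f).integrable_mul (Lp.memLp g)

theorem norm_integral_mul_Lp_le (h : q.toReal.HolderConjugate p.toReal) [Fact (1 ≤ q)]
    [Fact (1 ≤ p)] (f : Lp ℂ q m)
    (g : Lp ℂ p m) : ‖∫ x, f x * g x ∂m‖ ≤ ‖g‖ * ‖f‖ := by
  have : ENNReal.HolderTriple q p 1 := ENNReal.HolderConjugate.of_toReal h
  have h1 := (ContinuousLinearMap.mul ℂ ℂ).norm_holder_apply_apply_le (r := 1) f g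
  have h2 := (ContinuousLinearMap.mul ℂ ℂ).coeFn_holder (r := 1) f g
  have h3 : ∫ x, f x * g x ∂m = ∫ x, (ContinuousLinearMap.mul ℂ ℂ).holder 1 f g x ∂m := by
    refine integral_congr_ae ?_
    filter_upwards [h2] with x hx
    rw [hx, ContinuousLinearMap.mul_apply']
  rw [h3]
  refine (norm_integral_le_integral_norm _).trans ?_
  rw [← L1.norm_eq_integral_norm]
  refine h1.trans ?_
  rw [mul_comm ‖g‖]
  refine mul_le_mul_of_nonneg_right ?_ (norm_nonneg _)
  exact mul_le_of_le_one_left (norm_nonneg _) (ContinuousLinearMap.opNorm_mul_le ℂ ℂ)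

/-- The functional on `L^q` given by the pairing with an element of `L^p`. -/
noncomputable def pairing (h : q.toReal.HolderConjugate p.toReal) [Fact (1 ≤ q)] [Fact (1 ≤ p)]
    (g : Lp ℂ p m) :
    StrongDual ℂ (Lp ℂ q m) :=
  LinearMap.mkContinuous
    { toFun := fun f => ∫ x, f x * g x ∂m
      map_add' := fun f f' => by
        rw [← integral_add (integrable_mul_Lp h f g) (integrable_mul_Lp h f' g)]
        refine integral_congr_ae ?_
        filter_upwards [Lp.coeFn_add f f'] with x hx
        rw [hx, Pi.add_apply, add_mul]
      map_smul' := fun c f => by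
        rw [RingHom.id_apply, smul_eq_mul, ← integral_const_mul]
        refine integral_congr_ae ?_
        filter_upwards [Lp.coeFn_smul c f] with x hx
        rw [hx, Pi.smul_apply, smul_eq_mul, mul_assoc] } ‖g‖ fun f => norm_integral_mul_Lp_le h f g

theorem pairing_apply (h : q.toReal.HolderConjugate p.toReal) [Fact (1 ≤ q)] [Fact (1 ≤ p)]
    (g : Lp ℂ p m)
    (f : Lp ℂ q m) : pairing h g f = ∫ x, f x * g x ∂m := rfl

theorem norm_pairing_le (h : q.toReal.HolderConjugate p.toReal) [Fact (1 ≤ q)] [Fact (1 ≤ p)]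
    (g : Lp ℂ p m) :
    ‖pairing h g‖ ≤ ‖g‖ :=
  LinearMap.mkContinuous_norm_le _ (norm_nonneg _) _

end Pairing

/-- A linear representation that preserves the norm is an isometric representation. -/
theorem exists_isometricRep {G E : Type*} [Group G] [NormedAddCommGroup E] [NormedSpace ℂ E]
    (ρ : G → E →ₗ[ℂ] E) (h1 : ∀ b, ρ 1 b = b) (hmul : ∀ x y b, ρ (x * y) b = ρ x (ρ y b))
    (hn : ∀ x b, ‖ρ x b‖ = ‖b‖) : ∃ π : G →* (E ≃ₗᵢ[ℂ] E), ∀ x b, π x b = ρ x b := by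
  let F : G → (E ≃ₗᵢ[ℂ] E) := fun x =>
    ⟨LinearEquiv.ofLinearMap (ρ x) (ρ x⁻¹)
      (LinearMap.ext fun b => by
        rw [LinearMap.comp_apply, ← hmul, mul_inv_cancel, h1, LinearMap.id_apply])
      (LinearMap.ext fun b => by
        rw [LinearMap.comp_apply, ← hmul, inv_mul_cancel, h1, LinearMap.id_apply]), hn x⟩
  exact ⟨MonoidHom.mk' F fun x y => LinearIsometryEquiv.ext (hmul x y), fun x b => rfl⟩

/-- A pointwise limit of coefficients `⟨λ(x) ηᵢ, ξᵢ⟩` of the representation on `L^q` given by a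
measure preserving action is a coefficient of an isometric representation on an `L^q` space. -/
theorem exists_rep_of_tendsto_coefficients {G : Type w} [Group G] {ι : Type v} {Y : Type u}
    [MeasurableSpace Y] {m : Measure Y} {p q : ℝ≥0∞} [Fact (1 ≤ q)] [Fact (1 ≤ p)]
    (h : q.toReal.HolderConjugate p.toReal) (τ : G → Y → Y) (hτ : ∀ x, MeasurePreserving (τ x) m m)
    (hτ1 : ∀ y, τ 1 y = y) (hτmul : ∀ x x' y, τ (x * x') y = τ x' (τ x y)) (U : Ultrafilter ι)
    (η : ι → Lp ℂ q m) (ξ : ι → Lp ℂ p m) (s : ι → ℝ) {C σ : ℝ}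
    (hη : ∀ i, ‖η i‖ ^ q.toReal = s i) (hξ : ∀ i, ‖ξ i‖ ^ p.toReal = s i) (hC : ∀ i, s i ≤ C)
    (hσ : Tendsto s U (𝓝 σ)) {f : G → ℂ}
    (hf : ∀ x, Tendsto (fun i => ∫ y, η i (τ x y) * ξ i y ∂m) U (𝓝 (f x))) :
    ∃ (X : Type (max u v)) (_ : MeasurableSpace X) (ν : Measure X)
      (π : G →* (Lp ℂ q ν ≃ₗᵢ[ℂ] Lp ℂ q ν)) (η' : Lp ℂ q ν) (ξ' : Lp ℂ p ν),
      ‖η'‖ * ‖ξ'‖ ≤ σ ∧ ∀ x, f x = ∫ t, (π x η') t * ξ' t ∂ν := by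
  have hq0 := ne_zero_of_toReal_holderConjugate h
  have hq := ne_top_of_toReal_holderConjugate h
  have hs0 : ∀ i, 0 ≤ s i := fun i => by rw [← hη]; positivity
  have hσ0 : 0 ≤ σ := ge_of_tendsto' hσ hs0
  have hηn : ∀ i, ‖η i‖ = s i ^ q.toReal⁻¹ := fun i => by
    rw [← hη, Real.rpow_rpow_inv (norm_nonneg _) h.ne_zero]
  have hξn : ∀ i, ‖ξ i‖ = s i ^ p.toReal⁻¹ := fun i => by
    rw [← hξ, Real.rpow_rpow_inv (norm_nonneg _) h.symm.ne_zero]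
  have hsC : ∀ i (r : ℝ), 0 ≤ r → s i ^ r ≤ C ^ r := fun i r hr =>
    Real.rpow_le_rpow (hs0 i) (hC i) hr
  let P := (LpSystem (m := m) hq0 hq).ultrapower h.pos U
  have hP : P.MultiplicityFree := multiplicityFree_ultrapower_LpSystem hq0 hq
  obtain ⟨X, mX, ν, ⟨S⟩⟩ := hP.exists_linearIsometryEquiv_Lp hq
  let T : G → Lp ℂ q m →ₗ[ℂ] Lp ℂ q m := fun x => Lp.compMeasurePreservingₗ ℂ (τ x) (hτ x)
  have hTae : ∀ x k, T x k =ᵐ[m] fun y => k (τ x y) := fun x k =>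
    Lp.coeFn_compMeasurePreserving k (hτ x)
  have hTn : ∀ x k, ‖T x k‖ = ‖k‖ := fun x k => Lp.norm_compMeasurePreserving k (hτ x)
  have hT1 : ∀ k, T 1 k = k := fun k => Lp.ext <| by
    filter_upwards [hTae 1 k] with y hy
    rw [hy, hτ1]
  -- The maps τ compose in reversed order, and pulling back reverses the order again.
  have hTmul : ∀ x x' k, T (x * x') k = T x (T x' k) := fun x x' k => Lp.ext <| by
    filter_upwards [hTae (x * x') k, hTae x (T x' k),
      (hτ x).quasiMeasurePreserving.ae (hTae x' k)] with y h1 h2 h3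
    rw [h1, h2, h3, hτmul]
  let M : G → Ultrapower U (Lp ℂ q m) →ₗ[ℂ] Ultrapower U (Lp ℂ q m) := fun x =>
    Ultrapower.map U (fun _ => T x) fun _ k => (hTn x k).le
  have hM : ∀ x k, M x (Ultrapower.mk U k) = Ultrapower.mk U
      (Ultrapower.familyMap (fun _ => T x) (fun _ k => (hTn x k).le) k) := fun x k =>
    Ultrapower.map_mk _ _ _
  obtain ⟨π, hπ⟩ := exists_isometricRep
    (fun x => (S.toLinearEquiv.toLinearMap ∘ₗ M x) ∘ₗ S.symm.toLinearEquiv.toLinearMap)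
    (fun b => by
      obtain ⟨k, hk⟩ := Ultrapower.mk_surjective (S.symm b)
      change S (M 1 (S.symm b)) = b
      have : Ultrapower.familyMap (fun _ => T 1) (fun _ k => (hTn 1 k).le) k = k := by
        ext1; funext i; exact hT1 (k i)
      rw [← hk, hM, this, hk, S.apply_symm_apply])
    (fun x x' b => by
      change S (M (x * x') (S.symm b)) = S (M x (S.symm (S (M x' (S.symm b)))))
      rw [S.symm_apply_apply]
      congr 1
      exact Ultrapower.map_comp _ _ _ _ _ _ (fun _ k => hTmul x x' k) _)
    (fun x b => by
      change ‖S (M x (S.symm b))‖ = ‖b‖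
      obtain ⟨k, hk⟩ := Ultrapower.mk_surjective (S.symm b)
      rw [S.norm_map, ← S.symm.norm_map b, ← hk, hM]
      exact tendsto_nhds_unique (Ultrapower.tendsto_norm _)
        ((Ultrapower.tendsto_norm k).congr fun i => (hTn x (k i)).symm))
  obtain ⟨Φ, hΦ⟩ := Ultrapower.exists_functional (U := U) (fun i => pairing h (ξ i))
    (C ^ p.toReal⁻¹) fun i => (norm_pairing_le h (ξ i)).trans
      ((hξn i).trans_le (hsC i _ h.symm.inv_nonneg))
  let k : lp (fun _ : ι => Lp ℂ q m) ∞ := ⟨η, memℓp_infty ⟨C ^ q.toReal⁻¹, by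
    rintro _ ⟨i, rfl⟩; exact (hηn i).trans_le (hsC i _ h.inv_nonneg)⟩⟩
  have hknorm : ‖Ultrapower.mk U k‖ = σ ^ q.toReal⁻¹ :=
    tendsto_nhds_unique (Ultrapower.tendsto_norm k)
      ((hσ.rpow_const (.inr h.inv_nonneg)).congr fun i => (hηn i).symm)
  have hΦn : ∀ b, ‖Φ b‖ ≤ σ ^ p.toReal⁻¹ * ‖b‖ := by
    intro b
    obtain ⟨k, rfl⟩ := Ultrapower.mk_surjective b
    refine le_of_tendsto_of_tendsto' (hΦ k).norm
      ((hσ.rpow_const (p := p.toReal⁻¹) (.inr h.symm.inv_nonneg)).mul (Ultrapower.tendsto_norm k))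
      fun i => ?_
    rw [← hξn]
    exact norm_integral_mul_Lp_le h (k i) (ξ i)
  have hfΦ : ∀ x, f x = Φ (M x (Ultrapower.mk U k)) := fun x => by
    rw [hM]
    refine tendsto_nhds_unique ((hf x).congr fun i => ?_) (hΦ _)
    refine integral_congr_ae ?_
    filter_upwards [hTae x (η i)] with y hy
    exact congrArg (· * ξ i y) hy.symm
  have hπS : ∀ x, π x (S (Ultrapower.mk U k)) = S (M x (Ultrapower.mk U k)) := fun x => by
    rw [hπ]
    change S (M x (S.symm (S (Ultrapower.mk U k)))) = _
    rw [S.symm_apply_apply]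
  suffices ∃ ξ' : Lp ℂ p ν, ‖ξ'‖ ≤ σ ^ p.toReal⁻¹ ∧ ∀ b, Φ b = ∫ t, S b t * ξ' t ∂ν by
    obtain ⟨ξ', hξ', hrepr⟩ := this
    refine ⟨X, mX, ν, π, S (Ultrapower.mk U k), ξ', ?_, fun x => ?_⟩
    · rw [S.norm_map, hknorm]
      refine (mul_le_mul_of_nonneg_left hξ' (by positivity)).trans ?_
      rw [← Real.rpow_add_of_nonneg hσ0 h.inv_nonneg h.symm.inv_nonneg, h.inv_add_inv_eq_one,
        Real.rpow_one]
    · rw [hfΦ, hrepr, hπS]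
  -- Each coordinate norms ξ i, so Φ takes at the class of g the value σ = σ^(1/p) σ^(1/q), the
  -- largest that its bound allows.
  let g : lp (fun _ : ι => Lp ℂ q m) ∞ := ⟨fun i => dualLp h.symm (ξ i),
    memℓp_infty ⟨C ^ q.toReal⁻¹, by
      rintro _ ⟨i, rfl⟩
      have h1 := norm_dualLp_rpow h.symm (ξ i)
      rw [hξ] at h1
      change ‖dualLp h.symm (ξ i)‖ ≤ _
      rw [← Real.rpow_rpow_inv (norm_nonneg (dualLp h.symm (ξ i))) h.ne_zero, h1]
      exact hsC i _ h.inv_nonneg⟩⟩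
  have hgn : ‖Ultrapower.mk U g‖ = σ ^ q.toReal⁻¹ := by
    refine tendsto_nhds_unique (Ultrapower.tendsto_norm g)
      ((hσ.rpow_const (.inr h.inv_nonneg)).congr fun i => ?_)
    have h1 := norm_dualLp_rpow h.symm (ξ i)
    rw [hξ] at h1
    rw [← h1, Real.rpow_rpow_inv (norm_nonneg _) h.ne_zero]
  have hΦg : Φ (Ultrapower.mk U g) = σ := by
    refine tendsto_nhds_unique (hΦ g) (((Complex.continuous_ofReal.tendsto σ).comp hσ).congr
      fun i => ?_)
    have h1 := integral_mul_dualLp h.symm (ξ i)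
    rw [hξ] at h1
    rw [Function.comp_apply, ← h1, pairing_apply]
    exact integral_congr_ae (ae_of_all _ fun y => mul_comm _ _)
  -- For σ = 0 the class of g is zero and cannot serve as a norming vector, but then Φ = 0.
  rcases hσ0.eq_or_lt with h0 | hpos
  · refine ⟨0, by rw [norm_zero]; positivity, fun b => ?_⟩
    have h1 := hΦn b
    rw [← h0, Real.zero_rpow (inv_ne_zero h.symm.ne_zero), zero_mul] at h1
    rw [norm_le_zero_iff.1 h1]
    refine (integral_eq_zero_of_ae ?_).symm
    filter_upwards [Lp.coeFn_zero ℂ p ν] with t ht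
    rw [ht]
    exact mul_zero _
  · obtain ⟨ξ', h1, h2⟩ := exists_integral_repr_of_norm_attained h
      (Φ.comp S.symm.toContinuousLinearEquiv.toContinuousLinearMap) (M := σ ^ p.toReal⁻¹)
      (g := S (Ultrapower.mk U g)) (fun b => (hΦn (S.symm b)).trans_eq (by rw [S.symm.norm_map]))
      (by
        rw [← norm_ne_zero_iff, S.norm_map, hgn]
        exact (Real.rpow_pos_of_pos hpos _).ne')
      (by
        change Φ (S.symm (S (Ultrapower.mk U g))) = _
        rw [S.symm_apply_apply, hΦg, S.norm_map, hgn, ← Real.rpow_add hpos, add_comm,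
          h.inv_add_inv_eq_one, Real.rpow_one])
    refine ⟨ξ', h1, fun b => ?_⟩
    rw [← h2 (S b)]
    change Φ b = Φ (S.symm (S b))
    rw [S.symm_apply_apply]

/-! ### From an expansion to a single coefficient -/

section SumMeasure

variable {K : Type*} [MeasurableSpace K] {ν : ℕ → Measure K} {p : ℝ≥0∞}

theorem ofReal_norm_rpow_Lp {Z : Type*} [MeasurableSpace Z] {m : Measure Z} (hp0 : p ≠ 0)
    (hp : p ≠ ∞) (f : Lp ℂ p m) :
    ∫⁻ x, ‖f x‖ₑ ^ p.toReal ∂m = ENNReal.ofReal (‖f‖ ^ p.toReal) := by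
  rw [Lp_norm_rpow_eq hp0 hp, ENNReal.ofReal_toReal (Lp_lintegral_rpow_ne_top hp0 hp f)]

theorem lintegral_sumMeasure {F : ℕ × K → ℝ≥0∞} (hF : Measurable F) :
    ∫⁻ z, F z ∂sumMeasure ν = ∑' n, ∫⁻ y, F (n, y) ∂ν n := by
  rw [sumMeasure, lintegral_sum_measure]
  exact tsum_congr fun n => lintegral_map hF measurable_prodMk_left

theorem hasSum_integral_sumMeasure {F : ℕ × K → ℂ} (hF : Integrable F (sumMeasure ν)) :
    HasSum (fun n => ∫ y, F (n, y) ∂ν n) (∫ z, F z ∂sumMeasure ν) := by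
  have h : HasSum (fun n => ∫ z, F z ∂(ν n).map (Prod.mk n)) (∫ z, F z ∂sumMeasure ν) :=
    hasSum_integral_measure hF
  refine (congrArg (HasSum · _) (funext fun n => ?_)).mp h
  exact integral_map measurable_prodMk_left.aemeasurable
    (hF.1.mono_measure (Measure.le_sum (fun n => (ν n).map (Prod.mk n)) n))

/-- The ℓ^p-sum of the spaces L^p(ν n) sits in L^p of the disjoint union. -/
theorem exists_Lp_sumMeasure [Fact (1 ≤ p)] (hp0 : p ≠ 0) (hp : p ≠ ∞) (f : ∀ n, Lp ℂ p (ν n)) {s : ℝ}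
    (hs : HasSum (fun n => ‖f n‖ ^ p.toReal) s) :
    ∃ F : Lp ℂ p (sumMeasure ν), ‖F‖ ^ p.toReal = s ∧
      F =ᵐ[sumMeasure ν] fun z => f z.1 z.2 := by
  have hm : Measurable fun z : ℕ × K => f z.1 z.2 :=
    measurable_from_prod_countable_right fun n => (Lp.stronglyMeasurable (f n)).measurable
  have hl : ∫⁻ z, ‖f z.1 z.2‖ₑ ^ p.toReal ∂sumMeasure ν = ENNReal.ofReal s := by
    rw [lintegral_sumMeasure (hm.enorm.pow_const _), ← hs.tsum_eq,
      ENNReal.ofReal_tsum_of_nonneg (fun n => by positivity) hs.summable]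
    exact tsum_congr fun n => ofReal_norm_rpow_Lp hp0 hp (f n)
  have hF : MemLp (fun z : ℕ × K => f z.1 z.2) p (sumMeasure ν) :=
    ⟨hm.aestronglyMeasurable, (eLpNorm_lt_top_iff_lintegral_rpow_enorm_lt_top hp0 hp).2
      (hl ▸ ENNReal.ofReal_lt_top)⟩
  refine ⟨hF.toLp _, ?_, hF.coeFn_toLp⟩
  rw [Lp_norm_rpow_eq hp0 hp, lintegral_congr_ae (g := fun z => ‖f z.1 z.2‖ₑ ^ p.toReal), hl,
    ENNReal.toReal_ofReal (hs.nonneg fun n => by positivity)]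
  filter_upwards [hF.coeFn_toLp] with z hz
  rw [hz]

theorem measurePreserving_prodMap_sumMeasure {τ : K → K}
    (hτ : ∀ n, MeasurePreserving τ (ν n) (ν n)) :
    MeasurePreserving (Prod.map id τ : ℕ × K → ℕ × K) (sumMeasure ν) (sumMeasure ν) := by
  have hm : Measurable (Prod.map id τ : ℕ × K → ℕ × K) :=
    measurable_from_prod_countable_right fun n =>
      measurable_prodMk_left.comp (hτ n).measurable
  refine ⟨hm, Measure.ext fun s hs => ?_⟩
  rw [Measure.map_apply hm hs, sumMeasure_apply ν hs, sumMeasure_apply ν (hm hs)]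
  exact tsum_congr fun n => (hτ n).measure_preimage
    (measurable_prodMk_left hs).nullMeasurableSet

end SumMeasure

namespace FigaTalamancaHerz

/-- Balancing makes the q-th and p-th powers both equal to ‖k‖‖e‖, so ∑ ‖ξₙ‖‖ηₙ‖ governs both the
ℓ^q-sum and the ℓ^p-sum. The scalars are inverse to each other because 1/q + 1/p = 1; if a vector is
zero, both scalars are 0 and the product of the two vectors is zero anyway. -/
theorem exists_scaled_pair {E F : Type*} [NormedAddCommGroup E] [NormedSpace ℂ E]
    [NormedAddCommGroup F] [NormedSpace ℂ F] {q p : ℝ} (h : q.HolderConjugate p) (e : E) (k : F) :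
    ∃ c d : ℝ, ‖(c : ℂ) • e‖ ^ q = ‖k‖ * ‖e‖ ∧ ‖(d : ℂ) • k‖ ^ p = ‖k‖ * ‖e‖ ∧
      (c * d = 1 ∨ e = 0 ∨ k = 0) := by
  by_cases he : e = 0
  · refine ⟨0, 0, ?_, ?_, Or.inr (Or.inl he)⟩
    · simp [he, Real.zero_rpow h.ne_zero]
    · simp [he, Real.zero_rpow h.symm.ne_zero]
  by_cases hk : k = 0
  · refine ⟨0, 0, ?_, ?_, Or.inr (Or.inr hk)⟩
    · simp [hk, Real.zero_rpow h.ne_zero]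
    · simp [hk, Real.zero_rpow h.symm.ne_zero]
  have he' := norm_pos_iff.2 he
  have hk' := norm_pos_iff.2 hk
  have ha : 0 < ‖k‖ * ‖e‖ := mul_pos hk' he'
  have key : ∀ r t : ℝ, r ≠ 0 → 0 < t → ∀ {B : Type _} [NormedAddCommGroup B] [NormedSpace ℂ B]
      (b : B), ‖b‖ = t → ‖((((‖k‖ * ‖e‖) ^ r⁻¹ / t : ℝ) : ℂ)) • b‖ ^ r = ‖k‖ * ‖e‖ := by
    intro r t hr ht B _ _ b hb
    rw [norm_smul, Complex.norm_real, Real.norm_of_nonneg (by positivity), hb,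
      div_mul_cancel₀ _ ht.ne', Real.rpow_inv_rpow ha.le hr]
  refine ⟨(‖k‖ * ‖e‖) ^ q⁻¹ / ‖e‖, (‖k‖ * ‖e‖) ^ p⁻¹ / ‖k‖, key q _ h.ne_zero he' e rfl, ?_,
    Or.inl ?_⟩
  · rw [norm_smul, Complex.norm_real, Real.norm_of_nonneg (by positivity),
      div_mul_cancel₀ _ hk'.ne', Real.rpow_inv_rpow ha.le h.symm.ne_zero]
  · rw [div_mul_div_comm, ← Real.rpow_add ha, h.inv_add_inv_eq_one, Real.rpow_one,
      mul_comm ‖e‖, div_self ha.ne']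

theorem IsExpansion.exists_integral_eq {G : Type*} [Group G] [MeasurableSpace G] [MeasurableMul G]
    {μ : Measure G} [μ.IsMulLeftInvariant] {p q : ℝ≥0∞} [Fact (1 ≤ p)] [Fact (1 ≤ q)]
    (h : q.toReal.HolderConjugate p.toReal) {f : G → ℂ} {ξ : ℕ → Lp ℂ p μ} {η : ℕ → Lp ℂ q μ}
    {s : ℝ} (hf : IsExpansion μ p q f ξ η s) :
    ∃ (H : Lp ℂ q (sumMeasure fun _ : ℕ => μ)) (Ξ : Lp ℂ p (sumMeasure fun _ : ℕ => μ)),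
      ‖H‖ ^ q.toReal = s ∧ ‖Ξ‖ ^ p.toReal = s ∧
      ∀ x, f x = ∫ z, H (Prod.map id (x⁻¹ * ·) z) * Ξ z ∂sumMeasure fun _ : ℕ => μ := by
  choose c d hc hd hcd using fun n => exists_scaled_pair h (η n) (ξ n)
  obtain ⟨H, hHn, hH⟩ := exists_Lp_sumMeasure (ν := fun _ => μ) (ne_zero_of_toReal_holderConjugate h)
    (ne_top_of_toReal_holderConjugate h) (fun n => (c n : ℂ) • η n)
    (s := s) (by simpa only [hc] using hf.hasSum_norm)
  obtain ⟨Ξ, hΞn, hΞ⟩ := exists_Lp_sumMeasure (ν := fun _ => μ)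
    (ne_zero_of_toReal_holderConjugate h.symm)
    (ne_top_of_toReal_holderConjugate h.symm) (fun n => (d n : ℂ) • ξ n)
    (s := s) (by simpa only [hd] using hf.hasSum_norm)
  refine ⟨H, Ξ, hHn, hΞn, fun x => ?_⟩
  have hτ := measurePreserving_prodMap_sumMeasure (ν := fun _ => μ)
    fun _ => measurePreserving_mul_left μ x⁻¹
  let F : ℕ × G → ℂ := fun z =>
    ((c z.1 : ℂ) • η z.1) (x⁻¹ * z.2) * ((d z.1 : ℂ) • ξ z.1) z.2
  have hHF : (fun z => H (Prod.map id (x⁻¹ * ·) z) * Ξ z) =ᵐ[sumMeasure fun _ : ℕ => μ] F := by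
    filter_upwards [hτ.quasiMeasurePreserving.ae hH, hΞ] with z h1 h2
    rw [h1, h2]
    rfl
  have hint : Integrable F (sumMeasure fun _ : ℕ => μ) := by
    refine (integrable_mul_Lp h (Lp.compMeasurePreserving _ hτ H) Ξ).congr ?_
    filter_upwards [Lp.coeFn_compMeasurePreserving H hτ, hHF] with z h1 h2
    rw [h1, ← h2]
    rfl
  rw [integral_congr_ae hHF]
  refine (hf.hasSum_apply x).unique 
    ((congrArg (HasSum · _) (funext fun n => ?_)).mp (hasSum_integral_sumMeasure hint))
  refine integral_congr_ae ?_
  have hQ := (measurePreserving_mul_left μ x⁻¹).quasiMeasurePreserving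
  have h0 : ∀ {r : ℝ≥0∞} {g : Lp ℂ r μ}, g = 0 → ∀ᵐ y ∂μ, g y = 0 := fun {r g} hg => by
    rw [hg]
    exact Lp.coeFn_zero ℂ r μ
  have h1 : ∀ᵐ y ∂μ, (c n * d n = 1) ∨ (η n) (x⁻¹ * y) = 0 ∨ ξ n y = 0 := by
    rcases hcd n with h' | h' | h'
    · exact Eventually.of_forall fun _ => Or.inl h'
    · filter_upwards [hQ.ae (h0 h')] with y hy using Or.inr (Or.inl hy)
    · filter_upwards [h0 h'] with y hy using Or.inr (Or.inr hy)
  filter_upwards [hQ.ae (Lp.coeFn_smul (c n : ℂ) (η n)), Lp.coeFn_smul (d n : ℂ) (ξ n), h1]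
    with y h2 h3 h4
  -- The convolution is thus the pairing of ξ n with the left translate of η n by x.
  have h5 : check (η n) (y⁻¹ * x) = η n (x⁻¹ * y) := by simp [check]
  simp only [F, h2, h3, h5, Pi.smul_apply, smul_eq_mul]
  rcases h4 with h4 | h4 | h4
  · have h6 : (c n : ℂ) * d n = 1 := by exact_mod_cast h4
    linear_combination (η n (x⁻¹ * y) * ξ n y) * h6
  · rw [h4]; ring
  · rw [h4]; ring

end FigaTalamancaHerz

/-! ### The proposition -/

theorem proposition2p3
    {G : Type u} [Group G] [TopologicalSpace G] [IsTopologicalGroup G] [LocallyCompactSpace G]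
    [MeasurableSpace G] [BorelSpace G]
    (μ : Measure G) [μ.IsHaarMeasure] [μ.Regular]
    (p p' : ℝ≥0∞) [Fact (1 ≤ p)] [Fact (1 ≤ p')] [p.HolderConjugate p']
    (hp : 1 < p) (hp_top : p < ∞)
    {ι : Type v} [Preorder ι] [IsDirectedOrder ι] [Nonempty ι]
    (fnet : ι → G → ℂ) (f : G → ℂ)
    (hmem : ∀ α, fnet α ∈ FigaTalamancaHerz.A μ p p')
    (hbdd : BddAbove (Set.range fun α => FigaTalamancaHerz.normA μ p p' (fnet α)))
    (hlim : ∀ x, Tendsto (fun α => fnet α x) atTop (𝓝 (f x))) :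
    ∃ (X : Type (max u v)) (_ : MeasurableSpace X) (ν : Measure X)
      (π : FigaTalamancaHerz.DiscreteIsometricRep G (Lp ℂ p' ν)),
      FigaTalamancaHerz.IsCoefficientFunction π f ∧
      ∀ C : ℝ, 0 ≤ C → (∀ α, FigaTalamancaHerz.normA μ p p' (fnet α) ≤ C) →
        ∃ (η : Lp ℂ p' ν) (ξ : Lp ℂ p ν), ‖η‖ * ‖ξ‖ ≤ C ∧
          ∀ x, f x = ∫ t, (π x η) t * ξ t ∂ν := by
  have hp'1 : p' ≠ ∞ := ((ENNReal.HolderConjugate.lt_top_iff_one_lt p' p).2 hp).ne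
  have h : p'.toReal.HolderConjugate p.toReal :=
    (ENNReal.HolderConjugate.toReal_of_ne_top hp_top.ne hp'1).symm
  -- The supremum is the least admissible C, so one choice of vectors serves every C.
  set C₀ : ℝ := ⨆ α, FigaTalamancaHerz.normA μ p p' (fnet α)
  have hle : ∀ α, FigaTalamancaHerz.normA μ p p' (fnet α) ≤ C₀ := fun α => le_ciSup hbdd α
  -- The infimum defining the norm need not be attained; the extra index in ℕ lets the excess tend
  -- to zero along the ultrafilter.
  have hex : ∀ i : ι × ℕ, ∃ s, (∃ ξ η, FigaTalamancaHerz.IsExpansion μ p p' (fnet i.1) ξ η s) ∧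
      s < C₀ + 1 / ((i.2 : ℝ) + 1) := fun i => by
    obtain ⟨ξ, η, s, hs⟩ := hmem i.1
    have h1 : FigaTalamancaHerz.normA μ p p' (fnet i.1) < C₀ + 1 / ((i.2 : ℝ) + 1) :=
      lt_add_of_le_of_pos (hle i.1) Nat.one_div_pos_of_nat
    exact exists_lt_of_csInf_lt ⟨s, ξ, η, hs⟩ h1
  choose s hs hsC using hex
  choose ξ η hs using hs
  choose H Ξ hH hΞ hint using fun i => (hs i).exists_integral_eq h
  have hs0 : ∀ i, 0 ≤ s i := fun i =>
    (hs i).hasSum_norm.nonneg fun n => mul_nonneg (norm_nonneg _) (norm_nonneg _)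
  have hs1 : ∀ i, s i ≤ C₀ + 1 := fun i => (hsC i).le.trans <| by
    gcongr
    rw [div_le_one (by positivity)]
    simp
  let U : Ultrafilter (ι × ℕ) := Ultrafilter.of (atTop ×ˢ atTop)
  have hU : (U : Filter (ι × ℕ)) ≤ atTop ×ˢ atTop := Ultrafilter.of_le _
  have hU1 : Tendsto Prod.fst (U : Filter (ι × ℕ)) atTop := tendsto_fst.mono_left hU
  have hU2 : Tendsto Prod.snd (U : Filter (ι × ℕ)) atTop := tendsto_snd.mono_left hU
  obtain ⟨σ, -, hσ⟩ := isCompact_Icc.ultrafilter_le_nhds (U.map s)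
    (le_principal_iff.2 <| Ultrafilter.mem_map.2 <|
      Filter.univ_mem' fun i => (⟨hs0 i, hs1 i⟩ : s i ∈ Set.Icc 0 (C₀ + 1)))
  have hσ : Tendsto s U (𝓝 σ) := hσ
  have hσC : σ ≤ C₀ := by
    have h1 : Tendsto (fun i : ι × ℕ => C₀ + 1 / ((i.2 : ℝ) + 1)) U (𝓝 (C₀ + 0)) :=
      tendsto_const_nhds.add (tendsto_one_div_add_atTop_nhds_zero_nat.comp hU2)
    rw [add_zero] at h1
    exact le_of_tendsto_of_tendsto' hσ h1 fun i => (hsC i).le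
  obtain ⟨X, mX, ν, π, η', ξ', hn, hf⟩ := exists_rep_of_tendsto_coefficients h
    (fun x : G => (Prod.map id (x⁻¹ * ·) : ℕ × G → ℕ × G))
    (fun x => measurePreserving_prodMap_sumMeasure (ν := fun _ => μ)
      fun _ => measurePreserving_mul_left μ x⁻¹)
    (fun y => Prod.ext rfl (by simp)) (fun x x' y => Prod.ext rfl (by simp [mul_assoc])) U H Ξ s hH hΞ hs1 hσ (f := f)
    fun x => ((hlim x).comp hU1).congr fun i => hint i x
  refine ⟨X, mX, ν, π, ⟨η', pairing h ξ', hf⟩, fun C _ hC => ⟨η', ξ', ?_, hf⟩⟩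
  exact hn.trans (hσC.trans (ciSup_le hC))
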